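/- Let $\mathcal E_{2,2}$ be the induced ensemble of random qubits: the law of the density matrix $\rho=\operatorname{Tr}_2|\psi\rangle\langle\psi|$ obtained by tracing out the second factor of a Haar-distributed pure state $\psi$ (a uniformly distributed unit vector) of $\mathbb C^2\otimes\mathbb C^2$. Write a qubit density matrix as $\rho(\mathbf r)=\frac12(\mathbb 1_2+r_x\sigma_x+r_y\sigma_y+r_z\sigma_z)$, where $\sigma_x,\sigma_y,\sigma_z$ are the Pauli matrices and $\mathbf r\in\mathbb R^3$, $|\mathbf r|\le 1$, is the Bloch vector. For $n\in\{3,4,5\}$ let $\rho_1,\dots,\rho_n$ be independent random qubits, each distributed according to $\mathcal E_{2,2}$, and let $r=|\mathbf r|\in[0,1]$ be the length of the Bloch vector of the equiprobable mixture $\rho(\mathbf r)=\frac1n\sum_{j=1}^n\rho_j$. Then the law of $r$ has a probability density $p^{(n)}$ on $[0,1]$, given explicitly as follows. (i) For $n=3$, $$p^{(3)}(r)=\begin{cases}\frac{6561}{2240}(1-r)^4\,r\,(9r^3+36r^2+27r-2), & r\in[\frac13,1],\\ -\frac{243}{1120}\,r^2\,(243r^6-1701r^4+945r^2-175), & r\in[0,\frac13].\end{cases}$$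 (ii) For $n=4$, $$p^{(4)}(r)=\begin{cases}\frac{512}{175}(1-r)^6\,r\,(16r^4+96r^3+156r^2+56r-9), & r\in[\frac12,1],\\ -\frac{128}{175}\,r^2\,(192r^9-2160r^7+960r^6+3780r^5-3528r^4+720r^2-85), & r\in[0,\frac12].\end{cases}$$ (iii) For $n=5$, $p^{(5)}(r)=f_R(r)$ for $r\in[\frac35,1]$, $p^{(5)}(r)=f_M(r)$ for $r\in[\frac15,\frac35]$ and $p^{(5)}(r)=f_L(r)$ for $r\in[0,\frac15]$, where $$f_R(r)=\tfrac{1953125}{16400384}(1-r)^8\,r\,(625r^5+5000r^4+12750r^3+11300r^2+1825r-612),$$ $$\begin{aligned}f_M(r)=-\tfrac{5}{4100096}\,r\,\bigl(&244140625r^{13}-3808593750r^{11}+2792968750r^{10}+12568359375r^9\\&-19103906250r^8-670312500r^7+18098437500r^6-12978590625r^5\\&+2511437500r^4+360038250r^3+44625750r^2-75822175r+67086\bigr),\end{aligned}$$ $$\begin{aligned}f_L(r)=\tfrac{125}{8200192}\,r^2\,\bigl(&29296875r^{12}-457031250r^{10}+1508203125r^8-938437500r^6\\&+316441125r^4-63050130r^2+5855707\bigr).\end{aligned}$$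 In each case the formulas agree at the common break points. -/

import Mathlib

open MeasureTheory ProbabilityTheory Set
open scoped Matrix

noncomputable section

/-- The Hilbert space `ℂ^d ⊗ ℂ^k` of a composite system, with vectors given by their coordinates in
the product basis. -/
abbrev CompositeSpace (d k : ℕ) : Type := EuclideanSpace ℂ (Fin d × Fin k)

/-- The law of a Haar-distributed pure state of `ℂ^d ⊗ ℂ^k`: the uniform (normalized surface)
probability measure on the unit sphere. -/
def haarPureState (d k : ℕ) : Measure (Metric.sphere (0 : CompositeSpace d k) 1) :=
  ((volume : Measure (CompositeSpace d k)).toSphere univ)⁻¹ •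
    (volume : Measure (CompositeSpace d k)).toSphere

/-- The partial trace `Tr_k |ψ⟩⟨ψ|` over the `k`-dimensional subsystem. -/
def reducedState {d k : ℕ} (ψ : CompositeSpace d k) : Matrix (Fin d) (Fin d) ℂ :=
  Matrix.of fun i j => ∑ l : Fin k, ψ (i, l) * star (ψ (j, l))

instance instMeasurableSpaceComplexMatrix (m n : Type*) : MeasurableSpace (Matrix m n ℂ) :=
  inferInstanceAs (MeasurableSpace (m → n → ℂ))

/-- The law of a random state of the induced ensemble `E_{d,k}`: the partial trace over the
`k`-dimensional subsystem of a Haar-distributed pure state of the `dk`-dimensional system. -/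
def inducedEnsemble (d k : ℕ) : Measure (Matrix (Fin d) (Fin d) ℂ) :=
  (haarPureState d k).map fun ψ => reducedState ψ.1

/-- The Pauli matrices `σ_x, σ_y, σ_z`. -/
def pauli : Fin 3 → Matrix (Fin 2) (Fin 2) ℂ :=
  ![!![0, 1; 1, 0], !![0, -Complex.I; Complex.I, 0], !![1, 0; 0, -1]]

/-- The qubit `ρ(r) = (1 + r · σ) / 2` with Bloch vector `r`. -/
def blochState (r : EuclideanSpace ℝ (Fin 3)) : Matrix (Fin 2) (Fin 2) ℂ :=
  (1 / 2 : ℂ) • (1 + ∑ i, (r i : ℂ) • pauli i)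

/-- The Bloch vector of a qubit, with coordinates `Tr (ρ σ_i)`. -/
def blochVector (ρ : Matrix (Fin 2) (Fin 2) ℂ) : EuclideanSpace ℝ (Fin 3) :=
  WithLp.toLp 2 fun i => (ρ * pauli i).trace.re

/-- The Bloch vector of `ρ(r)` is `r`. -/
theorem blochVector_blochState (r : EuclideanSpace ℝ (Fin 3)) :
    blochVector (blochState r) = r := by
  ext i
  fin_cases i <;>
    simp [blochVector, blochState, pauli, Fin.sum_univ_three, Matrix.trace, Fin.sum_univ_two,
      Matrix.mul_apply] <;> ring

/-- A Hermitian `2 × 2` matrix of trace one is the qubit with its Bloch vector. -/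
theorem blochState_blochVector {ρ : Matrix (Fin 2) (Fin 2) ℂ} (hρ : ρ.IsHermitian)
    (htr : ρ.trace = 1) : blochState (blochVector ρ) = ρ := by
  have h00 := congrArg Complex.im (hρ.apply 0 0)
  have h11 := congrArg Complex.im (hρ.apply 1 1)
  have h01 := hρ.apply 0 1
  have h01r := congrArg Complex.re h01
  have h01i := congrArg Complex.im h01
  have htr' := congrArg Complex.re htr
  simp [Matrix.trace, Fin.sum_univ_two] at h00 h11 h01r h01i htr'
  ext i j
  fin_cases i <;> fin_cases j <;> apply Complex.ext <;>
    simp [blochVector, blochState, pauli, Fin.sum_univ_three, Matrix.trace, Fin.sum_univ_two,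
      Matrix.mul_apply] <;> linarith

/-- The equiprobable mixture `(1/n) ∑ ρ_j` of `n` states. -/
def equiprobableMixture {n : ℕ} (ρ : Fin n → Matrix (Fin 2) (Fin 2) ℂ) :
    Matrix (Fin 2) (Fin 2) ℂ :=
  (1 / n : ℂ) • ∑ j, ρ j

/-- `p`, restricted to `[0, 1]`, is a probability density function of the law `μ`, which is
carried by `[0, 1]`. -/
def IsDensityOnUnitInterval (μ : Measure ℝ) (p : ℝ → ℝ) : Prop :=
  (∀ r ∈ Icc (0 : ℝ) 1, 0 ≤ p r) ∧
    μ = (volume.restrict (Icc (0 : ℝ) 1)).withDensity fun r => ENNReal.ofReal (p r)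

/-- The length of the Bloch vector of the equiprobable mixture of the random qubits `ρ_1, …, ρ_n`. -/
def mixtureBlochLength {Ω : Type*} {n : ℕ} (ρ : Fin n → Ω → Matrix (Fin 2) (Fin 2) ℂ) (ω : Ω) : ℝ :=
  ‖blochVector (equiprobableMixture fun j => ρ j ω)‖

/-- `ρ_1, …, ρ_n` are independent random qubits from the ensemble `E_{2,2}`. -/
def IsIndepE22 {Ω : Type*} [MeasurableSpace Ω] (P : Measure Ω) {n : ℕ}
    (ρ : Fin n → Ω → Matrix (Fin 2) (Fin 2) ℂ) : Prop :=
  iIndepFun ρ P ∧ ∀ j, HasLaw (ρ j) (inducedEnsemble 2 2) P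

end

/-!
# The Bloch vector length of an equiprobable mixture of random qubits

A law on `[0, 1]` is identified as the law of the Bloch length `‖V‖` of the mixture through the
moment-generating function of the Bloch vector `V` itself.

* For a Haar-distributed `ψ ∈ ℂ² ⊗ ℂ²` and a unit vector `v`, the projection `⟪v, r⟫` of the Bloch
  vector of the reduced state is `2 ‖Pψ‖² - 1`, where `Pψ` collects the two coordinates of `ψ` along
  the eigenvector of `v · σ` of eigenvalue `1` (`inner_blochVector_reducedState`). The variable
  `‖Pψ‖²` has the beta distribution with parameters `(2, 2)` (`map_norm_fst_sq_eq_betaTwoTwo`): its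
  moments are ratios of Gamma integrals, as a Gaussian weight on `ℝ⁸` factorizes over `ℝ⁴ × ℝ⁴`.
  Hence `E exp ⟪v, r⟫ = φ ‖v‖` with `φ s = 3 (s cosh s - sinh s) / s ^ 3`, and by independence
  `E exp ⟪v, V⟫ = φ (‖v‖ / n) ^ n`.
* If `E exp ⟪v, V⟫ = ∫ sinh (‖v‖ r) / (‖v‖ r) dν(r)` for all `v ≠ 0`, then `ν` is the law of `‖V‖`
  (`map_norm_eq_of_lintegral_exp_inner`). Indeed, averaging both sides over a Gaussian vector `v`
  of covariance `s² • 1` gives `E exp (s² ‖V‖² / 2) = ∫ exp (s² r² / 2) dν(r)`, and a law is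
  determined by its moment-generating function.
* Let `ν` have density `r * q r` on `[0, 1]`, where `q` is odd and vanishes beyond `1`. The
  condition becomes `∫ x, q x * exp (u x) = 2 u φ (u / n) ^ n` for `u > 0`. The binomial expansion of
  `φ ^ n` exhibits the right-hand side as a combination of the terms `exp (a u) / u ^ (m + 1)`, which are
  the Laplace transforms of truncated powers of `a - x`. So `q` is the spline `radialSpline n`
  (`integral_radialSpline_mul_exp`), and the densities are obtained by expanding it between its
  knots.
-/

/-! ### Laws determined by exponential moments -/

/-- Moment-generating functions that are finite everywhere are analytic, so that it suffices to
compare them near a single point. -/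
theorem map_eq_of_frequently_mgf_eq {Ω Ω' : Type*} [MeasurableSpace Ω] [MeasurableSpace Ω']
    {μ : Measure Ω} {μ' : Measure Ω'} [IsProbabilityMeasure μ] [IsFiniteMeasure μ']
    {X : Ω → ℝ} {Y : Ω' → ℝ} (hX : AEMeasurable X μ) (hY : AEMeasurable Y μ')
    (hXi : ∀ t, Integrable (fun ω => Real.exp (t * X ω)) μ)
    (hYi : ∀ t, Integrable (fun ω => Real.exp (t * Y ω)) μ')
    (h : ∃ᶠ t in nhdsWithin 1 {1}ᶜ, mgf X μ t = mgf Y μ' t) :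
    μ.map X = μ'.map Y := by
  have hX' : integrableExpSet X μ = univ := eq_univ_of_forall hXi
  have hY' : integrableExpSet Y μ' = univ := eq_univ_of_forall hYi
  have h1 := analyticOnNhd_mgf (X := X) (μ := μ)
  have h2 := analyticOnNhd_mgf (X := Y) (μ := μ')
  rw [hX', interior_univ] at h1
  rw [hY', interior_univ] at h2
  have h3 : mgf X μ = mgf Y μ' := by
    funext t
    exact AnalyticOnNhd.eqOn_of_preconnected_of_frequently_eq h1 h2 isPreconnected_univ
      (mem_univ 1) h (mem_univ t)
  refine Measure.ext_of_complexMGF_eq hX hY ?_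
  funext z
  have := eqOn_complexMGF_of_mgf h3
  rw [hX', interior_univ] at this
  exact this (mem_univ z.re)

theorem map_eq_of_moments_eq {Ω Ω' : Type*} [MeasurableSpace Ω] [MeasurableSpace Ω']
    {μ : Measure Ω} {μ' : Measure Ω'} [IsProbabilityMeasure μ] [IsFiniteMeasure μ']
    {X : Ω → ℝ} {Y : Ω' → ℝ} (hX : AEMeasurable X μ) (hY : AEMeasurable Y μ')
    (hXi : ∀ t, Integrable (fun ω => Real.exp (t * X ω)) μ)
    (hYi : ∀ t, Integrable (fun ω => Real.exp (t * Y ω)) μ')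
    (h : ∀ k : ℕ, ∫ ω, X ω ^ k ∂μ = ∫ ω, Y ω ^ k ∂μ') :
    μ.map X = μ'.map Y := by
  have hX' : integrableExpSet X μ = univ := eq_univ_of_forall hXi
  have hY' : integrableExpSet Y μ' = univ := eq_univ_of_forall hYi
  have e1 : (0 : ℝ) ∈ interior (integrableExpSet X μ) := by simp [hX']
  have e2 : (0 : ℝ) ∈ interior (integrableExpSet Y μ') := by simp [hY']
  have h1 := analyticOnNhd_mgf (X := X) (μ := μ)
  have h2 := analyticOnNhd_mgf (X := Y) (μ := μ')
  rw [hX', interior_univ] at h1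
  rw [hY', interior_univ] at h2
  have f1 := hasFPowerSeriesAt_mgf e1
  have f2 := hasFPowerSeriesAt_mgf e2
  have h0 : ∀ᶠ t in nhds (0 : ℝ), mgf X μ t - mgf Y μ' t = 0 := by
    have hs : (FormalMultilinearSeries.ofScalars ℝ fun n =>
          (∫ ω, X ω ^ n * Real.exp (0 * X ω) ∂μ) / (n.factorial : ℝ)) =
        FormalMultilinearSeries.ofScalars ℝ fun n =>
          (∫ ω, Y ω ^ n * Real.exp (0 * Y ω) ∂μ') / (n.factorial : ℝ) := by
      congr 1
      funext n
      simp [h]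
    refine HasFPowerSeriesAt.eventually_eq_zero (𝕜 := ℝ) (x := 0) ?_
    have f3 := f1.sub f2
    rwa [hs, sub_self] at f3
  refine map_eq_of_frequently_mgf_eq hX hY hXi hYi ?_
  have h3 : mgf X μ = mgf Y μ' := by
    funext t
    refine AnalyticOnNhd.eqOn_of_preconnected_of_frequently_eq h1 h2 isPreconnected_univ
      (mem_univ 0) ?_ (mem_univ t)
    refine Filter.Eventually.frequently ?_
    filter_upwards [nhdsWithin_le_nhds h0] with t ht
    linarith
  exact Filter.Eventually.frequently (Filter.Eventually.of_forall fun t => by rw [h3])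

/-! ### Gaussian integrals -/

theorem integral_eq_integral_Ioi_add_neg {f : ℝ → ℝ} (hf : Integrable f) :
    ∫ x, f x = ∫ x in Ioi (0 : ℝ), (f x + f (-x)) := by
  have hc : Integrable fun x => f (-x) := hf.comp_neg
  rw [integral_add hf.integrableOn hc.integrableOn, integral_comp_neg_Ioi 0 f, neg_zero, add_comm,
    intervalIntegral.integral_Iic_add_Ioi hf.integrableOn hf.integrableOn]

theorem integrable_mul_exp_mul_gaussian (a : ℝ) :
    Integrable (fun x : ℝ => x * Real.exp (a * x - x ^ 2 / 2)) ∧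
    ∫ x : ℝ, x * Real.exp (a * x - x ^ 2 / 2) = √(2 * Real.pi) * (a * Real.exp (a ^ 2 / 2)) := by
  have hi : Integrable (fun x : ℝ => x) (gaussianReal a 1) :=
    (memLp_id_gaussianReal 1).integrable le_rfl
  have hm := integral_id_gaussianReal (μ := a) (v := 1)
  have hs : √(2 * Real.pi) ≠ 0 := by positivity
  -- Completing the square turns the integrand into the density of `gaussianReal a 1`.
  have key : ∀ x : ℝ, x * Real.exp (a * x - x ^ 2 / 2)
      = (√(2 * Real.pi) * Real.exp (a ^ 2 / 2)) * (gaussianPDFReal a 1 x • x) := by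
    intro x
    simp only [gaussianPDFReal, NNReal.coe_one, mul_one, smul_eq_mul]
    have : a * x - x ^ 2 / 2 = a ^ 2 / 2 + -(x - a) ^ 2 / 2 := by ring
    rw [this, Real.exp_add]
    field_simp
  simp_rw [key]
  constructor
  · refine Integrable.const_mul ?_ _
    rw [gaussianReal_of_var_ne_zero _ one_ne_zero,
      integrable_withDensity_iff_integrable_smul' (by fun_prop)
        (Filter.Eventually.of_forall fun x => gaussianPDF_lt_top)] at hi
    simpa [toReal_gaussianPDF] using hi
  · rw [integral_const_mul, ← integral_gaussianReal_eq_integral_smul one_ne_zero, hm]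
    ring

/-- The Gaussian average of `sinh (a ‖y‖) / (a ‖y‖)` over `ℝ³`, which is also the Gaussian average
of `exp ⟪y, v⟫` when `‖v‖ = a`. -/
theorem lintegral_gaussian_sinh_norm {a : ℝ} (ha : 0 < a) :
    ∫⁻ y : EuclideanSpace ℝ (Fin 3),
      ENNReal.ofReal (Real.exp (-‖y‖ ^ 2 / 2) * (Real.sinh (a * ‖y‖) / (a * ‖y‖)))
      = ENNReal.ofReal ((2 * Real.pi) ^ (3 / 2 : ℝ) * Real.exp (a ^ 2 / 2)) := by
  obtain ⟨hi, hv⟩ := integrable_mul_exp_mul_gaussian a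
  have hi' : Integrable fun x : ℝ => -x * Real.exp (a * -x - (-x) ^ 2 / 2) := hi.comp_neg
  have e : ∀ x ∈ Ioi (0 : ℝ),
      x ^ 2 * (Real.exp (-x ^ 2 / 2) * (Real.sinh (a * x) / (a * x))) =
      (1 / (2 * a)) * (x * Real.exp (a * x - x ^ 2 / 2)
        + -x * Real.exp (a * -x - (-x) ^ 2 / 2)) := by
    intro x hx
    have hx : 0 < x := hx
    have h1 : a * x - x ^ 2 / 2 = -x ^ 2 / 2 + a * x := by ring
    have h2 : a * -x - (-x) ^ 2 / 2 = -x ^ 2 / 2 + -(a * x) := by ring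
    rw [h1, h2, Real.exp_add, Real.exp_add, Real.sinh_eq]
    field_simp
    ring
  have hd : Module.finrank ℝ (EuclideanSpace ℝ (Fin 3)) = 3 := by simp
  rw [← ofReal_integral_eq_lintegral_ofReal]
  · congr 1
    rw [integral_fun_norm_addHaar volume
      (fun r => Real.exp (-r ^ 2 / 2) * (Real.sinh (a * r) / (a * r))), hd]
    simp only [smul_eq_mul, Nat.add_one_sub_one]
    rw [setIntegral_congr_fun measurableSet_Ioi e, integral_const_mul,
      ← integral_eq_integral_Ioi_add_neg hi, hv]
    have h3 : (2 * Real.pi) ^ (3 / 2 : ℝ) = 2 * Real.pi * √(2 * Real.pi) := by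
      rw [Real.sqrt_eq_rpow, show (3 / 2 : ℝ) = 1 + 1 / 2 by norm_num,
        Real.rpow_add (by positivity), Real.rpow_one]
    rw [h3, measureReal_def, EuclideanSpace.volume_ball_fin_three]
    simp only [ENNReal.ofReal_one, one_pow, one_mul]
    rw [ENNReal.toReal_ofReal (by positivity)]
    simp only [nsmul_eq_mul]
    field_simp
    norm_num
    try ring
  · rw [integrable_fun_norm_addHaar volume
      (f := fun r => Real.exp (-r ^ 2 / 2) * (Real.sinh (a * r) / (a * r))), hd]
    simp only [smul_eq_mul, Nat.add_one_sub_one]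
    refine IntegrableOn.congr_fun ?_ (fun x hx => (e x hx).symm) measurableSet_Ioi
    exact ((hi.add hi').const_mul _).integrableOn
  · refine Filter.Eventually.of_forall fun y => ?_
    have : 0 ≤ a * ‖y‖ := by positivity
    have := Real.sinh_nonneg_iff.2 this
    simp only [Pi.zero_apply]
    positivity

theorem lintegral_gaussian_exp_inner (v : EuclideanSpace ℝ (Fin 3)) :
    ∫⁻ y : EuclideanSpace ℝ (Fin 3), ENNReal.ofReal (Real.exp (-‖y‖ ^ 2 / 2 + inner ℝ v y))
      = ENNReal.ofReal ((2 * Real.pi) ^ (3 / 2 : ℝ) * Real.exp (‖v‖ ^ 2 / 2)) := by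
  have h := GaussianFourier.integral_cexp_neg_mul_sq_norm_add (b := 1 / 2) (by norm_num) 1 v
  have hv : ∫ y : EuclideanSpace ℝ (Fin 3), Real.exp (-‖y‖ ^ 2 / 2 + inner ℝ v y)
      = (2 * Real.pi) ^ (3 / 2 : ℝ) * Real.exp (‖v‖ ^ 2 / 2) := by
    apply Complex.ofReal_injective
    rw [← integral_complex_ofReal]
    push_cast [Complex.ofReal_cpow (by positivity : 0 ≤ 2 * Real.pi)]
    rw [finrank_euclideanSpace_fin] at h
    refine (integral_congr_ae (Filter.Eventually.of_forall fun y => ?_)).trans (h.trans ?_)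
    · rw [neg_mul]
      ring_nf
    · congr 2
      · ring
      · ring
  rw [← hv, ofReal_integral_eq_lintegral_ofReal]
  -- The integral does not vanish, so that it is not the junk value of a divergent one.
  · by_contra hn
    rw [integral_undef hn] at hv
    have : 0 < (2 * Real.pi) ^ (3 / 2 : ℝ) * Real.exp (‖v‖ ^ 2 / 2) := by positivity
    exact this.ne hv
  · exact Filter.Eventually.of_forall fun y => (Real.exp_pos _).le

/-! ### The length of an isotropic random vector of `ℝ³` -/

/-- The result of averaging the identity `h` over a centred Gaussian vector `v = s • y`. -/
theorem lintegral_exp_sq_norm_eq {Ω : Type*} [MeasurableSpace Ω] {P : Measure Ω}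
    [IsProbabilityMeasure P] {V : Ω → EuclideanSpace ℝ (Fin 3)} (hV : AEMeasurable V P)
    {ν : Measure ℝ} [IsFiniteMeasure ν] (hν : ∀ᵐ r ∂ν, r ∈ Ioc (0 : ℝ) 1)
    (h : ∀ v ≠ 0, ∫⁻ ω, ENNReal.ofReal (Real.exp (inner ℝ v (V ω))) ∂P
      = ∫⁻ r, ENNReal.ofReal (Real.sinh (‖v‖ * r) / (‖v‖ * r)) ∂ν) {s : ℝ} (hs : 0 < s) :
    ∫⁻ ω, ENNReal.ofReal (Real.exp (s ^ 2 / 2 * ‖V ω‖ ^ 2)) ∂P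
      = ∫⁻ r, ENNReal.ofReal (Real.exp (s ^ 2 / 2 * r ^ 2)) ∂ν := by
  set K := ENNReal.ofReal ((2 * Real.pi) ^ (3 / 2 : ℝ)) with hK
  have hK0 : K ≠ 0 := by
    rw [hK, Ne, ENNReal.ofReal_eq_zero, not_le]
    positivity
  have hKt : K ≠ ⊤ := ENNReal.ofReal_ne_top
  have hpi : 0 ≤ (2 * Real.pi) ^ (3 / 2 : ℝ) := by positivity
  refine (ENNReal.mul_right_inj hK0 hKt).1 ?_
  calc K * ∫⁻ ω, ENNReal.ofReal (Real.exp (s ^ 2 / 2 * ‖V ω‖ ^ 2)) ∂P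
      = ∫⁻ ω, (∫⁻ y : EuclideanSpace ℝ (Fin 3),
          ENNReal.ofReal (Real.exp (-‖y‖ ^ 2 / 2 + inner ℝ (s • V ω) y))) ∂P := by
        rw [← lintegral_const_mul' _ _ hKt]
        refine lintegral_congr fun ω => ?_
        rw [lintegral_gaussian_exp_inner, hK, ← ENNReal.ofReal_mul hpi, norm_smul, mul_pow,
          Real.norm_eq_abs, sq_abs]
        ring_nf
    _ = ∫⁻ y : EuclideanSpace ℝ (Fin 3), ∫⁻ ω,
          ENNReal.ofReal (Real.exp (-‖y‖ ^ 2 / 2 + inner ℝ (s • V ω) y)) ∂P := by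
        refine lintegral_lintegral_swap ?_
        have h1 : AEMeasurable (fun z : Ω × EuclideanSpace ℝ (Fin 3) => V z.1) (P.prod volume) :=
          hV.comp_quasiMeasurePreserving Measure.quasiMeasurePreserving_fst
        simp only [Function.uncurry_def]
        fun_prop
    _ = ∫⁻ y : EuclideanSpace ℝ (Fin 3), ∫⁻ r,
          ENNReal.ofReal (Real.exp (-‖y‖ ^ 2 / 2) *
            (Real.sinh (s * r * ‖y‖) / (s * r * ‖y‖))) ∂ν := by
        have h0 : ∀ᵐ y : EuclideanSpace ℝ (Fin 3), y ≠ 0 := by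
          simp [ae_iff, measure_singleton]
        refine lintegral_congr_ae ?_
        filter_upwards [h0] with y hy
        have h1 := h (s • y) (smul_ne_zero hs.ne' hy)
        have h2 : ∀ ω, ENNReal.ofReal (Real.exp (-‖y‖ ^ 2 / 2 + inner ℝ (s • V ω) y)) =
            ENNReal.ofReal (Real.exp (-‖y‖ ^ 2 / 2)) *
              ENNReal.ofReal (Real.exp (inner ℝ (s • y) (V ω))) := fun ω => by
          rw [← ENNReal.ofReal_mul (Real.exp_pos _).le, ← Real.exp_add, inner_smul_left,
            inner_smul_left, real_inner_comm]
        simp_rw [h2]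
        rw [lintegral_const_mul' _ _ ENNReal.ofReal_ne_top, h1,
          ← lintegral_const_mul' _ _ ENNReal.ofReal_ne_top]
        refine lintegral_congr fun r => ?_
        rw [← ENNReal.ofReal_mul (Real.exp_pos _).le, norm_smul, Real.norm_of_nonneg hs.le]
        ring_nf
    _ = ∫⁻ r, (∫⁻ y : EuclideanSpace ℝ (Fin 3),
          ENNReal.ofReal (Real.exp (-‖y‖ ^ 2 / 2) *
            (Real.sinh (s * r * ‖y‖) / (s * r * ‖y‖)))) ∂ν := by
        refine lintegral_lintegral_swap ?_
        simp only [Function.uncurry_def, Real.sinh_eq]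
        fun_prop
    _ = K * ∫⁻ r, ENNReal.ofReal (Real.exp (s ^ 2 / 2 * r ^ 2)) ∂ν := by
        rw [← lintegral_const_mul' _ _ hKt]
        refine lintegral_congr_ae ?_
        filter_upwards [hν] with r hr
        rw [lintegral_gaussian_sinh_norm (mul_pos hs hr.1), hK, ← ENNReal.ofReal_mul hpi]
        ring_nf

/-- The law of the length of an isotropic random vector of `ℝ³` is determined by the
moment-generating function of the vector: `sinh (‖v‖ r) / (‖v‖ r)` is the mean of `exp ⟪v, x⟫` over
the sphere of radius `r`. Isotropy need not be assumed, since it follows from `h`. -/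
theorem map_norm_eq_of_lintegral_exp_inner {Ω : Type*} [MeasurableSpace Ω] {P : Measure Ω}
    [IsProbabilityMeasure P] {V : Ω → EuclideanSpace ℝ (Fin 3)} (hV : AEMeasurable V P)
    {ν : Measure ℝ} [IsFiniteMeasure ν] (hν : ∀ᵐ r ∂ν, r ∈ Ioc (0 : ℝ) 1)
    (h : ∀ v ≠ 0, ∫⁻ ω, ENNReal.ofReal (Real.exp (inner ℝ v (V ω))) ∂P
      = ∫⁻ r, ENNReal.ofReal (Real.sinh (‖v‖ * r) / (‖v‖ * r)) ∂ν) :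
    P.map (fun ω => ‖V ω‖) = ν := by
  have hX : AEMeasurable (fun ω => ‖V ω‖ ^ 2) P := by fun_prop
  have hY : AEMeasurable (fun r : ℝ => r ^ 2) ν := by fun_prop
  have key : ∀ t > 0, ∫⁻ ω, ENNReal.ofReal (Real.exp (t * ‖V ω‖ ^ 2)) ∂P
      = ∫⁻ r, ENNReal.ofReal (Real.exp (t * r ^ 2)) ∂ν := by
    intro t ht
    have := lintegral_exp_sq_norm_eq hV hν h (s := √(2 * t)) (by positivity)
    rwa [Real.sq_sqrt (by positivity), mul_div_cancel_left₀ _ two_ne_zero] at this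
  have hYi : ∀ t : ℝ, Integrable (fun r : ℝ => Real.exp (t * r ^ 2)) ν := by
    intro t
    refine Integrable.of_bound (by fun_prop) (Real.exp |t|) ?_
    filter_upwards [hν] with r hr
    rw [Real.norm_of_nonneg (Real.exp_pos _).le, Real.exp_le_exp]
    have h1 : r ^ 2 ≤ 1 := by nlinarith [hr.1, hr.2]
    calc t * r ^ 2 ≤ |t| * r ^ 2 := by gcongr; exact le_abs_self t
      _ ≤ |t| * 1 := by gcongr
      _ = |t| := mul_one _
  have hXi : ∀ t : ℝ, Integrable (fun ω => Real.exp (t * ‖V ω‖ ^ 2)) P := by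
    intro t
    rcases le_or_gt t 0 with ht | ht
    · refine Integrable.of_bound (by fun_prop) 1 (Filter.Eventually.of_forall fun ω => ?_)
      rw [Real.norm_of_nonneg (Real.exp_pos _).le, Real.exp_le_one_iff]
      exact mul_nonpos_of_nonpos_of_nonneg ht (by positivity)
    · refine ⟨by fun_prop, ?_⟩
      rw [hasFiniteIntegral_iff_ofReal (Filter.Eventually.of_forall fun ω => (Real.exp_pos _).le),
        key t ht]
      exact ((hYi t).lintegral_lt_top)
  have hm : P.map (fun ω => ‖V ω‖ ^ 2) = ν.map (fun r : ℝ => r ^ 2) := by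
    refine map_eq_of_frequently_mgf_eq hX hY hXi hYi (Filter.Eventually.frequently ?_)
    filter_upwards [nhdsWithin_le_nhds (lt_mem_nhds one_pos)] with t ht
    have h0 := fun x : ℝ => (Real.exp_pos x).le
    rw [mgf, mgf, integral_eq_lintegral_of_nonneg_ae (Filter.Eventually.of_forall fun _ => h0 _)
      (hXi t).1, integral_eq_lintegral_of_nonneg_ae (Filter.Eventually.of_forall fun _ => h0 _)
      (hYi t).1, key t ht]
  have hm' := congrArg (Measure.map Real.sqrt) hm
  rw [AEMeasurable.map_map_of_aemeasurable (by fun_prop) hX,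
    AEMeasurable.map_map_of_aemeasurable (by fun_prop) hY] at hm'
  have e1 : Real.sqrt ∘ (fun ω => ‖V ω‖ ^ 2) = fun ω => ‖V ω‖ := by
    funext ω
    simp [Real.sqrt_sq]
  rw [e1] at hm'
  rw [hm']
  calc ν.map (Real.sqrt ∘ fun r : ℝ => r ^ 2) = ν.map id := by
        refine Measure.map_congr ?_
        filter_upwards [hν] with r hr
        simp [Real.sqrt_sq hr.1.le]
    _ = ν := Measure.map_id

/-! ### Radial integration of homogeneous functions -/

/-- Integration in polar coordinates of a positively homogeneous function against a radial one. -/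
theorem integral_homogeneous_mul_fun_norm {E : Type*} [NormedAddCommGroup E] [NormedSpace ℝ E]
    [FiniteDimensional ℝ E] [Nontrivial E] [MeasurableSpace E] [BorelSpace E] (μ : Measure E)
    [μ.IsAddHaarMeasure] {f : E → ℝ} (g : ℝ → ℝ) {k : ℕ}
    (hf : ∀ r : ℝ, 0 < r → ∀ x, f (r • x) = r ^ k * f x) :
    ∫ x, f x * g ‖x‖ ∂μ = (∫ u : Metric.sphere (0 : E) 1, f u ∂μ.toSphere) *
      ∫ r in Ioi (0 : ℝ), r ^ (Module.finrank ℝ E - 1) * (r ^ k * g r) := by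
  calc ∫ x, f x * g ‖x‖ ∂μ
      = ∫ x : ({(0)}ᶜ : Set E), f x.1 * g ‖x.1‖ ∂(μ.comap (↑)) := by
        rw [integral_subtype_comap (measurableSet_singleton _).compl fun x => f x * g ‖x‖,
          restrict_compl_singleton]
    _ = ∫ p : Metric.sphere (0 : E) 1 × Ioi (0 : ℝ), f p.1 * ((p.2 : ℝ) ^ k * g p.2)
          ∂μ.toSphere.prod (.volumeIoiPow (Module.finrank ℝ E - 1)) := by
        rw [← μ.measurePreserving_homeomorphUnitSphereProd.integral_comp
          (Homeomorph.measurableEmbedding _)]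
        refine integral_congr_ae (Filter.Eventually.of_forall fun x => ?_)
        have hx : 0 < ‖x.1‖ := norm_pos_iff.2 x.2
        have h1 := hf ‖x.1‖ hx (‖x.1‖⁻¹ • x.1)
        rw [smul_inv_smul₀ hx.ne'] at h1
        simp only [homeomorphUnitSphereProd_apply_fst_coe, homeomorphUnitSphereProd_apply_snd_coe]
        rw [h1]
        ring
    _ = (∫ u : Metric.sphere (0 : E) 1, f u ∂μ.toSphere) *
          ∫ r : Ioi (0 : ℝ), (r : ℝ) ^ k * g r ∂.volumeIoiPow (Module.finrank ℝ E - 1) :=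
        integral_prod_mul (fun u : Metric.sphere (0 : E) 1 => f u)
          (fun r : Ioi (0 : ℝ) => (r : ℝ) ^ k * g r)
    _ = _ := by
        congr 1
        simp only [Measure.volumeIoiPow, ENNReal.ofReal]
        rw [integral_withDensity_eq_integral_smul,
          integral_subtype_comap measurableSet_Ioi
            fun a => Real.toNNReal (a ^ (Module.finrank ℝ E - 1)) • (a ^ k * g a),
          setIntegral_congr_fun measurableSet_Ioi fun x hx => ?_]
        · rw [NNReal.smul_def, Real.coe_toNNReal _ (pow_nonneg hx.out.le _), smul_eq_mul]
        · exact (measurable_subtype_coe.pow_const _).real_toNNReal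

theorem integral_pow_mul_exp_neg_sq (m : ℕ) :
    ∫ r in Ioi (0 : ℝ), r ^ (2 * m + 1) * Real.exp (-r ^ 2) = m.factorial / 2 := by
  have h := integral_rpow_mul_exp_neg_rpow (p := 2) (q := 2 * m + 1) two_pos
    (by have : (0 : ℝ) ≤ m := m.cast_nonneg
        linarith)
  rw [show ((2 * m + 1 + 1) / 2 : ℝ) = m + 1 by ring, Real.Gamma_nat_eq_factorial] at h
  rw [show (m.factorial / 2 : ℝ) = 1 / 2 * m.factorial by ring, ← h]
  refine setIntegral_congr_fun measurableSet_Ioi fun r hr => ?_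
  have h1 : r ^ (2 * (m : ℝ) + 1) = r ^ (2 * m + 1) := by
    rw [← Real.rpow_natCast]
    push_cast
    rfl
  simp only [h1, Real.rpow_two]

/-! ### The squared norm of half of the coordinates of a random unit vector -/

/-- The beta distribution with parameters `(2, 2)`, of density `6 b (1 - b)` on `[0, 1]`. -/
noncomputable def betaTwoTwo : Measure ℝ :=
  (volume.restrict (Icc (0 : ℝ) 1)).withDensity fun b => ENNReal.ofReal (6 * b * (1 - b))

theorem integral_betaTwoTwo (f : ℝ → ℝ) :
    ∫ b, f b ∂betaTwoTwo = ∫ b in (0 : ℝ)..1, 6 * b * (1 - b) * f b := by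
  rw [betaTwoTwo, integral_withDensity_eq_integral_toReal_smul (by fun_prop)
    (Filter.Eventually.of_forall fun _ => ENNReal.ofReal_lt_top),
    intervalIntegral.integral_of_le zero_le_one, ← integral_Icc_eq_integral_Ioc]
  refine setIntegral_congr_fun measurableSet_Icc fun b hb => ?_
  have : 0 ≤ 6 * b * (1 - b) := mul_nonneg (by linarith [hb.1]) (by linarith [hb.2])
  simp only [ENNReal.toReal_ofReal this, smul_eq_mul]

instance : IsFiniteMeasure betaTwoTwo := by
  refine isFiniteMeasure_withDensity_ofReal ?_
  have : IntegrableOn (fun b : ℝ => 6 * b * (1 - b)) (Icc 0 1) :=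
    ContinuousOn.integrableOn_Icc (by fun_prop)
  exact this.2

theorem ae_betaTwoTwo_mem_Icc : ∀ᵐ b ∂betaTwoTwo, b ∈ Icc (0 : ℝ) 1 :=
  (withDensity_absolutelyContinuous _ _).ae_le (ae_restrict_mem measurableSet_Icc)

theorem integral_pow_betaTwoTwo (k : ℕ) :
    ∫ b, b ^ k ∂betaTwoTwo = 6 * ((k + 1).factorial / (k + 3).factorial) := by
  rw [integral_betaTwoTwo]
  have h : ∀ b : ℝ, 6 * b * (1 - b) * b ^ k = 6 * b ^ (k + 1) - 6 * b ^ (k + 2) := fun b => by ring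
  simp_rw [h]
  rw [intervalIntegral.integral_sub (by apply Continuous.intervalIntegrable; fun_prop)
    (by apply Continuous.intervalIntegrable; fun_prop), intervalIntegral.integral_const_mul,
    intervalIntegral.integral_const_mul, integral_pow, integral_pow]
  have h2 : ((k + 3).factorial : ℝ) = (k + 3) * ((k + 2) * (k + 1).factorial) := by
    rw [Nat.factorial_succ (k + 2), Nat.factorial_succ (k + 1)]
    push_cast
    ring
  have h3 : ((k + 1).factorial : ℝ) ≠ 0 := by positivity
  have h4 : (k : ℝ) + 2 ≠ 0 := by positivity
  have h5 : (k : ℝ) + 3 ≠ 0 := by positivity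
  rw [h2]
  push_cast
  field_simp
  simp
  ring

theorem integral_exp_betaTwoTwo {s : ℝ} (hs : s ≠ 0) :
    ∫ b, Real.exp (s * (2 * b - 1)) ∂betaTwoTwo
      = 3 * (s * Real.cosh s - Real.sinh s) / s ^ 3 := by
  rw [integral_betaTwoTwo]
  have hd : ∀ b ∈ uIcc (0 : ℝ) 1, HasDerivAt
      (fun b : ℝ => (3 * b * (1 - b) / s - 3 * (1 - 2 * b) / (2 * s ^ 2) - 3 / (2 * s ^ 3)) *
        Real.exp (s * (2 * b - 1)))
      (6 * b * (1 - b) * Real.exp (s * (2 * b - 1))) b := by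
    intro b _
    have h1 : HasDerivAt (fun b : ℝ => s * (2 * b - 1)) (s * (2 * 1)) b :=
      (((hasDerivAt_id b).const_mul 2).sub_const 1).const_mul s
    have h2 : HasDerivAt (fun b : ℝ => 3 * b * (1 - b)) (3 * 1 * (1 - b) + 3 * b * (-1)) b :=
      ((hasDerivAt_id b).const_mul 3).mul ((hasDerivAt_id b).const_sub 1)
    have h3 : HasDerivAt (fun b : ℝ => 3 * (1 - 2 * b)) (3 * (-(2 * 1))) b :=
      (((hasDerivAt_id b).const_mul 2).const_sub 1).const_mul 3
    have h4 := (((h2.div_const s).sub (h3.div_const (2 * s ^ 2))).sub_const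
      (3 / (2 * s ^ 3))).mul h1.exp
    refine h4.congr_deriv ?_
    simp only [Pi.sub_apply]
    field_simp
    ring
  rw [intervalIntegral.integral_eq_sub_of_hasDerivAt hd
    (by apply Continuous.intervalIntegrable; fun_prop), Real.cosh_eq, Real.sinh_eq]
  rw [show s * (2 * 1 - 1) = s by ring, show s * (2 * 0 - 1) = -s by ring]
  field_simp
  ring

section HalfNorm

variable {E F G : Type*} [NormedAddCommGroup E] [NormedSpace ℝ E] [FiniteDimensional ℝ E]
  [MeasurableSpace E] [BorelSpace E]
  [NormedAddCommGroup F] [NormedSpace ℝ F] [FiniteDimensional ℝ F]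
  [MeasurableSpace F] [BorelSpace F]
  [NormedAddCommGroup G] [NormedSpace ℝ G] [FiniteDimensional ℝ G]
  [MeasurableSpace G] [BorelSpace G]

theorem integral_norm_pow_mul_exp_neg_sq (μ : Measure F) [μ.IsAddHaarMeasure]
    (hF : Module.finrank ℝ F = 4) (k : ℕ) :
    ∫ u, ‖u‖ ^ (2 * k) * Real.exp (-‖u‖ ^ 2) ∂μ
      = 4 * μ.real (Metric.ball 0 1) * ((k + 1).factorial / 2) := by
  have : Nontrivial F := Module.nontrivial_of_finrank_pos (R := ℝ) (by omega)
  rw [integral_fun_norm_addHaar μ fun r => r ^ (2 * k) * Real.exp (-r ^ 2), hF,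
    ← integral_pow_mul_exp_neg_sq]
  simp only [nsmul_eq_mul, smul_eq_mul, Nat.add_one_sub_one]
  rw [← mul_assoc]
  push_cast
  congr 1
  refine setIntegral_congr_fun measurableSet_Ioi fun r _ => ?_
  ring

/-- Up to normalization, `∫ ‖(L u).1‖ ^ (2 k)` over the unit sphere is a ratio of Gamma integrals,
because the Gaussian weight `exp (-‖x‖ ^ 2)` factorizes along `L`. -/
theorem exists_integral_toSphere_norm_fst_pow (hE : Module.finrank ℝ E = 8)
    (hF : Module.finrank ℝ F = 4) (hG : Module.finrank ℝ G = 4) (L : E ≃L[ℝ] F × G)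
    (hL : ∀ x, ‖(L x).1‖ ^ 2 + ‖(L x).2‖ ^ 2 = ‖x‖ ^ 2) (μ : Measure E) [μ.IsAddHaarMeasure] :
    ∃ C : ℝ, ∀ k : ℕ,
      (∫ u : Metric.sphere (0 : E) 1, ‖(L u).1‖ ^ (2 * k) ∂μ.toSphere) * (k + 3).factorial
        = C * (k + 1).factorial := by
  have : Nontrivial E := Module.nontrivial_of_finrank_pos (R := ℝ) (by omega)
  let νF : Measure F := Measure.addHaar
  let νG : Measure G := Measure.addHaar
  have := L.isAddHaarMeasure_map μ
  -- The Haar measure on `E` is a multiple of the product measure; the factor `c` is absorbed in `C`.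
  obtain ⟨c, hc⟩ : ∃ c : NNReal, μ.map L = c • νF.prod νG :=
    ⟨_, Measure.isAddLeftInvariant_eq_smul _ _⟩
  refine ⟨2 * ((c : ℝ) * (4 * νF.real (Metric.ball 0 1) * (1 / 2) *
    (4 * νG.real (Metric.ball 0 1) * (1 / 2)))), fun k => ?_⟩
  have h1 := integral_homogeneous_mul_fun_norm μ (f := fun x => ‖(L x).1‖ ^ (2 * k))
    (fun r => Real.exp (-r ^ 2)) (k := 2 * k) (fun r hr x => by
      simp [norm_smul, abs_of_pos hr, mul_pow])
  have h2 : ∫ r in Ioi (0 : ℝ), r ^ (Module.finrank ℝ E - 1) * (r ^ (2 * k) * Real.exp (-r ^ 2))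
      = (k + 3).factorial / 2 := by
    rw [hE, ← integral_pow_mul_exp_neg_sq]
    refine setIntegral_congr_fun measurableSet_Ioi fun r _ => ?_
    ring
  have h3 : ∫ x, ‖(L x).1‖ ^ (2 * k) * Real.exp (-‖x‖ ^ 2) ∂μ
      = (c : ℝ) * ((4 * νF.real (Metric.ball 0 1) * ((k + 1).factorial / 2)) *
        (4 * νG.real (Metric.ball 0 1) * (1 / 2))) := by
    have h4 := integral_norm_pow_mul_exp_neg_sq νG hG 0
    have h5 := integral_map_equiv (μ := μ) L.toHomeomorph.toMeasurableEquiv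
      (fun p : F × G => (‖p.1‖ ^ (2 * k) * Real.exp (-‖p.1‖ ^ 2)) *
        (‖p.2‖ ^ (2 * 0) * Real.exp (-‖p.2‖ ^ 2)))
    have h6 : μ.map L.toHomeomorph.toMeasurableEquiv = c • νF.prod νG := hc
    rw [h6, integral_smul_nnreal_measure, NNReal.smul_def, integral_prod_mul (μ := νF) (ν := νG)
      (fun u : F => ‖u‖ ^ (2 * k) * Real.exp (-‖u‖ ^ 2))
      (fun w : G => ‖w‖ ^ (2 * 0) * Real.exp (-‖w‖ ^ 2)),
      integral_norm_pow_mul_exp_neg_sq νF hF, h4] at h5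
    simp only [zero_add, Nat.factorial_one, Nat.cast_one, smul_eq_mul] at h5
    rw [h5]
    refine integral_congr_ae (Filter.Eventually.of_forall fun x => ?_)
    have h7 : -‖x‖ ^ 2 = -‖(L x).1‖ ^ 2 + -‖(L x).2‖ ^ 2 := by rw [← hL]; ring
    have h8 : L.toHomeomorph.toMeasurableEquiv x = L x := rfl
    simp only [h8, h7, Real.exp_add]
    ring
  rw [h2, h3] at h1
  linear_combination -2 * h1

/-- For a uniformly distributed unit vector of an eight-dimensional space, the squared norm of the
component along a four-dimensional factor follows the beta distribution. -/
theorem map_norm_fst_sq_eq_betaTwoTwo (hE : Module.finrank ℝ E = 8)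
    (hF : Module.finrank ℝ F = 4) (hG : Module.finrank ℝ G = 4) (L : E ≃L[ℝ] F × G)
    (hL : ∀ x, ‖(L x).1‖ ^ 2 + ‖(L x).2‖ ^ 2 = ‖x‖ ^ 2) (μ : Measure E) [μ.IsAddHaarMeasure] :
    ((μ.toSphere univ)⁻¹ • μ.toSphere).map
      (fun u : Metric.sphere (0 : E) 1 => ‖(L u).1‖ ^ 2) = betaTwoTwo := by
  have : Nontrivial E := Module.nontrivial_of_finrank_pos (R := ℝ) (by omega)
  have hne : NeZero μ.toSphere := ⟨μ.toSphere_ne_zero⟩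
  have hprob : IsProbabilityMeasure ((μ.toSphere univ)⁻¹ • μ.toSphere) :=
    isProbabilityMeasureSMul
  have hcont : Continuous fun u : Metric.sphere (0 : E) 1 => ‖(L u).1‖ ^ 2 := by fun_prop
  have hb : ∀ u : Metric.sphere (0 : E) 1, ‖(L u).1‖ ^ 2 ≤ 1 := fun u => by
    have h1 := hL u
    have h2 : ‖(u : E)‖ = 1 := norm_eq_of_mem_sphere u
    rw [h2] at h1
    nlinarith [sq_nonneg ‖(L u).2‖]
  have hexp : ∀ t x : ℝ, 0 ≤ x → x ≤ 1 → ‖Real.exp (t * x)‖ ≤ Real.exp |t| := by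
    intro t x h0 h1
    rw [Real.norm_of_nonneg (Real.exp_pos _).le, Real.exp_le_exp]
    calc t * x ≤ |t| * x := by gcongr; exact le_abs_self t
      _ ≤ |t| * 1 := by gcongr
      _ = |t| := mul_one _
  -- The case `k = 0` of `hC` expresses `C` through the total mass of the sphere.
  obtain ⟨C, hC⟩ := exists_integral_toSphere_norm_fst_pow hE hF hG L hL μ
  have h0 := hC 0
  rw [map_eq_of_moments_eq (Y := id) (μ' := betaTwoTwo) hcont.measurable.aemeasurable
    aemeasurable_id, Measure.map_id]
  · intro t
    exact Integrable.of_bound (by fun_prop) (Real.exp |t|)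
      (Filter.Eventually.of_forall fun u => hexp t _ (by positivity) (hb u))
  · intro t
    refine Integrable.of_bound (by fun_prop) (Real.exp |t|) ?_
    filter_upwards [ae_betaTwoTwo_mem_Icc] with b hb
    exact hexp t b hb.1 hb.2
  · intro k
    have hk := hC k
    have hT : 0 < (μ.toSphere univ).toReal :=
      ENNReal.toReal_pos (Measure.measure_univ_ne_zero.2 hne.out) (measure_ne_top _ _)
    simp only [mul_zero, pow_zero, integral_const, smul_eq_mul, mul_one, zero_add,
      Nat.factorial_one, Nat.cast_one, measureReal_def] at h0
    simp only [id]
    rw [integral_smul_measure, integral_pow_betaTwoTwo]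
    simp_rw [← pow_mul]
    rw [ENNReal.toReal_inv, smul_eq_mul]
    have h3 : ((k + 3).factorial : ℝ) ≠ 0 := by positivity
    have h6 : ((3).factorial : ℝ) = 6 := by norm_num [Nat.factorial]
    rw [h6] at h0
    rw [← h0] at hk
    field_simp
    linear_combination hk

end HalfNorm

/-! ### The Bloch vector of a random qubit -/

/-- The coordinates of `z ∈ ℂ² ⊗ ℂ²` in the orthonormal basis `(a, β)`, `(-β̄, a)` of the first
factor, for real `a`. -/
noncomputable def splitCoords (a : ℝ) (β : ℂ) :
    CompositeSpace 2 2 →ₗ[ℝ] EuclideanSpace ℂ (Fin 2) × EuclideanSpace ℂ (Fin 2) where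
  toFun z := (WithLp.toLp 2 fun l => (a : ℂ) * z (0, l) + star β * z (1, l),
    WithLp.toLp 2 fun l => -β * z (0, l) + (a : ℂ) * z (1, l))
  map_add' x y := by
    refine Prod.ext ?_ ?_ <;> ext l <;> simp <;> ring
  map_smul' c x := by
    refine Prod.ext ?_ ?_ <;> ext l <;> simp <;> ring

theorem norm_sq_splitCoords {a : ℝ} {β : ℂ} (h : a ^ 2 + β.re ^ 2 + β.im ^ 2 = 1)
    (z : CompositeSpace 2 2) :
    ‖(splitCoords a β z).1‖ ^ 2 + ‖(splitCoords a β z).2‖ ^ 2 = ‖z‖ ^ 2 := by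
  simp only [EuclideanSpace.norm_sq_eq, splitCoords, LinearMap.coe_mk, AddHom.coe_mk,
    Fin.sum_univ_two, Fintype.sum_prod_type, Complex.sq_norm, Complex.normSq_apply]
  simp
  linear_combination ((z (0, 0)).re ^ 2 + (z (0, 0)).im ^ 2 + (z (0, 1)).re ^ 2 +
    (z (0, 1)).im ^ 2 + (z (1, 0)).re ^ 2 + (z (1, 0)).im ^ 2 + (z (1, 1)).re ^ 2 +
    (z (1, 1)).im ^ 2) * h

/-- The eigenvector of `v · σ` of eigenvalue `1` has coordinates `(a, β)` when `v` is the image of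
`(a, β)` under the Hopf map. -/
theorem inner_blochVector_reducedState {a : ℝ} {β : ℂ} {v : EuclideanSpace ℝ (Fin 3)}
    (h : a ^ 2 + β.re ^ 2 + β.im ^ 2 = 1)
    (h0 : v 0 = 2 * a * β.re) (h1 : v 1 = 2 * a * β.im)
    (h2 : v 2 = a ^ 2 - β.re ^ 2 - β.im ^ 2) (z : CompositeSpace 2 2) :
    inner ℝ v (blochVector (reducedState z)) = 2 * ‖(splitCoords a β z).1‖ ^ 2 - ‖z‖ ^ 2 := by
  simp only [PiLp.inner_apply, EuclideanSpace.norm_sq_eq, splitCoords, LinearMap.coe_mk,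
    AddHom.coe_mk, Fin.sum_univ_two, Fin.sum_univ_three, Fintype.sum_prod_type, Complex.sq_norm,
    Complex.normSq_apply, blochVector, reducedState, pauli, Matrix.trace]
  simp [h0, h1, h2, Matrix.mul_apply, Fin.sum_univ_two]
  linear_combination -((z (0, 0)).re ^ 2 + (z (0, 0)).im ^ 2 + (z (0, 1)).re ^ 2 +
    (z (0, 1)).im ^ 2 + (z (1, 0)).re ^ 2 + (z (1, 0)).im ^ 2 + (z (1, 1)).re ^ 2 +
    (z (1, 1)).im ^ 2) * h

/-- Every point of the unit sphere of `ℝ³` is the image of a point of `S³` under the Hopf map. -/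
theorem exists_hopf_preimage {v : EuclideanSpace ℝ (Fin 3)} (hv : ‖v‖ = 1) :
    ∃ (a : ℝ) (β : ℂ), a ^ 2 + β.re ^ 2 + β.im ^ 2 = 1 ∧ v 0 = 2 * a * β.re ∧
      v 1 = 2 * a * β.im ∧ v 2 = a ^ 2 - β.re ^ 2 - β.im ^ 2 := by
  have h : v 0 ^ 2 + v 1 ^ 2 + v 2 ^ 2 = 1 := by
    have := EuclideanSpace.norm_sq_eq v
    simp only [hv, Fin.sum_univ_three, Real.norm_eq_abs, sq_abs] at this
    linarith
  rcases eq_or_ne (v 2) (-1) with h2 | h2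
  · have h0 : v 0 = 0 := by nlinarith [sq_nonneg (v 0), sq_nonneg (v 1)]
    have h1 : v 1 = 0 := by nlinarith [sq_nonneg (v 0), sq_nonneg (v 1)]
    exact ⟨0, 1, by simp, by simp [h0], by simp [h1], by simp [h2]⟩
  -- Away from the south pole, `a = √((1 + v₂) / 2)` and `β = (v₀ + i v₁) / (2 a)`.
  · have h3 : 0 < 1 + v 2 := by
      have : -1 ≤ v 2 := by nlinarith [sq_nonneg (v 0), sq_nonneg (v 1)]
      have := lt_of_le_of_ne this h2.symm
      linarith
    have ha : 0 < √((1 + v 2) / 2) := by positivity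
    have ha2 : √((1 + v 2) / 2) ^ 2 = (1 + v 2) / 2 := Real.sq_sqrt (by positivity)
    set a := √((1 + v 2) / 2)
    have hb : (v 0 / (2 * a)) ^ 2 + (v 1 / (2 * a)) ^ 2 = (1 - v 2) / 2 := by
      rw [div_pow, div_pow, mul_pow, ha2]
      field_simp
      linear_combination h
    refine ⟨a, ⟨v 0 / (2 * a), v 1 / (2 * a)⟩, ?_, ?_, ?_, ?_⟩
    · linear_combination ha2 + hb
    · simp only; field_simp
    · simp only; field_simp
    · linear_combination hb - ha2

theorem measurable_reducedState (d k : ℕ) :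
    Measurable fun ψ : CompositeSpace d k => reducedState ψ := by
  refine measurable_pi_iff.2 fun i => measurable_pi_iff.2 fun j => ?_
  have : Continuous fun ψ : CompositeSpace d k => ∑ l : Fin k, ψ (i, l) * star (ψ (j, l)) := by
    fun_prop
  exact this.measurable

theorem measurable_blochVector : Measurable blochVector := by
  have h : ∀ i j, Measurable fun ρ : Matrix (Fin 2) (Fin 2) ℂ => ρ i j := fun i j =>
    (measurable_pi_apply j).comp (measurable_pi_apply i)
  refine (WithLp.measurable_toLp 2 _).comp (measurable_pi_iff.2 fun i => ?_)
  simp only [Matrix.trace, Matrix.mul_apply, Matrix.diag_apply]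
  refine Complex.measurable_re.comp ?_
  fun_prop

/-- Every projection `⟪v, r⟫` of the Bloch vector `r` of a random qubit on a unit vector `v` has
density `3 / 4 * (1 - x ^ 2)` on `[-1, 1]`, expressed here through `x = 2 b - 1`. -/
theorem map_inner_blochVector_inducedEnsemble {v : EuclideanSpace ℝ (Fin 3)} (hv : ‖v‖ = 1) :
    (inducedEnsemble 2 2).map (fun ρ => inner ℝ v (blochVector ρ))
      = betaTwoTwo.map fun b => 2 * b - 1 := by
  obtain ⟨a, β, h, h0, h1, h2⟩ := exists_hopf_preimage hv
  have hfin : Module.finrank ℝ (EuclideanSpace ℂ (Fin 2)) = 4 := by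
    rw [finrank_real_of_complex, finrank_euclideanSpace_fin]
  have hE : Module.finrank ℝ (CompositeSpace 2 2) = 8 := by
    rw [finrank_real_of_complex, finrank_euclideanSpace, Fintype.card_prod, Fintype.card_fin]
  have hinj : Function.Injective (splitCoords a β) := by
    refine (injective_iff_map_eq_zero _).2 fun z hz => ?_
    have := norm_sq_splitCoords h z
    rw [hz] at this
    simpa using this.symm
  let L := (LinearEquiv.ofInjectiveOfFinrankEq (splitCoords a β) hinj
    (by rw [Module.finrank_prod, hfin, hE])).toContinuousLinearEquiv
  have hL : ∀ z, L z = splitCoords a β z := fun z => rfl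
  have hbeta := map_norm_fst_sq_eq_betaTwoTwo hE hfin hfin L
    (fun z => by rw [hL]; exact norm_sq_splitCoords h z) volume
  have hm : Measurable fun ρ => inner ℝ v (blochVector ρ) :=
    measurable_blochVector.const_inner
  have hcont : Continuous fun u : Metric.sphere (0 : CompositeSpace 2 2) 1 => ‖(L u).1‖ ^ 2 := by
    fun_prop
  have hred : Measurable fun ψ : Metric.sphere (0 : CompositeSpace 2 2) 1 => reducedState ψ.1 :=
    (measurable_reducedState 2 2).comp measurable_subtype_coe
  rw [inducedEnsemble, Measure.map_map hm hred, ← hbeta,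
    Measure.map_map (by fun_prop) hcont.measurable]
  refine Measure.map_congr (Filter.Eventually.of_forall fun ψ => ?_)
  have hψ : ‖(ψ : CompositeSpace 2 2)‖ = 1 := norm_eq_of_mem_sphere ψ
  simp only [Function.comp_apply, inner_blochVector_reducedState h h0 h1 h2, hψ, hL, one_pow]

/-- The moment-generating function of the Bloch vector of a random qubit depends only on `‖v‖`. -/
theorem mgf_inner_blochVector_inducedEnsemble {v : EuclideanSpace ℝ (Fin 3)} (hv : v ≠ 0) :
    Integrable (fun ρ => Real.exp (inner ℝ v (blochVector ρ))) (inducedEnsemble 2 2) ∧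
    ∫ ρ, Real.exp (inner ℝ v (blochVector ρ)) ∂inducedEnsemble 2 2
      = 3 * (‖v‖ * Real.cosh ‖v‖ - Real.sinh ‖v‖) / ‖v‖ ^ 3 := by
  have hn : ‖v‖ ≠ 0 := norm_ne_zero_iff.2 hv
  have hlaw := map_inner_blochVector_inducedEnsemble (v := ‖v‖⁻¹ • v)
    (by rw [norm_smul, norm_inv, norm_norm, inv_mul_cancel₀ hn])
  have hm : Measurable fun ρ => inner ℝ (‖v‖⁻¹ • v) (blochVector ρ) :=
    measurable_blochVector.const_inner
  have hx : ∀ ρ, inner ℝ v (blochVector ρ) = ‖v‖ * inner ℝ (‖v‖⁻¹ • v) (blochVector ρ) := by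
    intro ρ
    rw [real_inner_smul_left, mul_inv_cancel_left₀ hn]
  have hint : Integrable (fun x => Real.exp (‖v‖ * x)) (betaTwoTwo.map fun b => 2 * b - 1) := by
    rw [integrable_map_measure (by fun_prop) (by fun_prop)]
    refine Integrable.of_bound (by fun_prop) (Real.exp ‖v‖) ?_
    filter_upwards [ae_betaTwoTwo_mem_Icc] with b hb
    simp only [Function.comp_apply]
    rw [Real.norm_of_nonneg (Real.exp_pos _).le, Real.exp_le_exp]
    nlinarith [hb.2, norm_nonneg v]
  simp_rw [hx]
  constructor
  · rw [← hlaw, integrable_map_measure (by fun_prop) hm.aemeasurable] at hint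
    exact hint
  · rw [← integral_exp_betaTwoTwo hn,
      ← integral_map (φ := fun b : ℝ => 2 * b - 1) (f := fun x => Real.exp (‖v‖ * x))
        (by fun_prop) (by fun_prop), ← hlaw, integral_map hm.aemeasurable (by fun_prop)]

/-! ### Laplace transforms of splines -/

theorem integral_max_pow_mul_exp {m : ℕ} (hm : m ≠ 0) (a : ℝ) {u : ℝ} (hu : 0 < u) :
    Integrable (fun x : ℝ => max (a - x) 0 ^ m * Real.exp (u * x)) ∧
    ∫ x : ℝ, max (a - x) 0 ^ m * Real.exp (u * x)
      = m.factorial * Real.exp (u * a) / u ^ (m + 1) := by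
  have hI : IntegrableOn (fun t : ℝ => t ^ m * Real.exp (-(u * t))) (Ioi 0) := by
    have := integrableOn_rpow_mul_exp_neg_mul_rpow (s := m) (p := 1)
      (by linarith [(m.cast_nonneg : (0 : ℝ) ≤ m)]) one_pos hu
    simpa using this
  have hv : ∫ t in Ioi (0 : ℝ), t ^ m * Real.exp (-(u * t)) = m.factorial / u ^ (m + 1) := by
    have := Real.integral_rpow_mul_exp_neg_mul_Ioi (a := m + 1) (r := u) (by positivity) hu
    simp only [add_sub_cancel_right, Real.rpow_natCast, Real.Gamma_nat_eq_factorial] at this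
    rw [this, ← Nat.cast_add_one, Real.rpow_natCast, one_div, inv_pow]
    field_simp
  have e : ∀ t : ℝ, max (a - (a - t)) 0 ^ m * Real.exp (u * (a - t)) =
      Real.exp (u * a) * (Ioi 0).indicator (fun t : ℝ => t ^ m * Real.exp (-(u * t))) t := by
    intro t
    rw [sub_sub_cancel, show u * (a - t) = u * a + -(u * t) by ring, Real.exp_add]
    by_cases ht : 0 < t
    · rw [indicator_of_mem (mem_Ioi.2 ht), max_eq_left ht.le]
      ring
    · rw [indicator_of_notMem (by simpa using ht), max_eq_right (not_lt.1 ht), zero_pow hm]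
      ring
  constructor
  · rw [← integrable_comp_sub_left _ a]
    simp_rw [e]
    exact (hI.integrable_indicator measurableSet_Ioi).const_mul _
  · rw [← integral_sub_left_eq_self _ volume a]
    simp_rw [e]
    rw [integral_const_mul, integral_indicator measurableSet_Ioi, hv]
    ring

/-- The polynomial in `y` whose truncation `y ↦ max y 0` has Laplace transform
`n.choose k * (u - n) ^ k * (u + n) ^ (n - k) / u ^ (3 * n - 1)`. -/
noncomputable def splineBlock (n k : ℕ) (y : ℝ) : ℝ :=
  n.choose k * ∑ i ∈ Finset.range (k + 1), ∑ l ∈ Finset.range (n - k + 1),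
    (k.choose i * (n - k).choose l * (-n : ℝ) ^ (k - i) * (n : ℝ) ^ (n - k - l)) *
      (y ^ (3 * n - 2 - i - l) / (3 * n - 2 - i - l).factorial)

/-- The spline with knots `(2 k - n) / n`, `0 ≤ k ≤ n`, such that `r * radialSpline n r` is the
density of the length of the mean of `n` independent uniform points of the unit ball of `ℝ³`. -/
noncomputable def radialSpline (n : ℕ) (x : ℝ) : ℝ :=
  2 * (3 * n ^ 2 / 2 : ℝ) ^ n *
    ∑ k ∈ Finset.range (n + 1), splineBlock n k (max ((2 * k - n) / n - x) 0)

theorem continuous_radialSpline (n : ℕ) : Continuous (radialSpline n) := by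
  unfold radialSpline splineBlock
  fun_prop

theorem splineBlock_zero {n k : ℕ} (hn : 2 ≤ n) (hk : k ≤ n) : splineBlock n k 0 = 0 := by
  unfold splineBlock
  rw [Finset.sum_eq_zero, mul_zero]
  intro i hi
  refine Finset.sum_eq_zero fun l hl => ?_
  rw [Finset.mem_range] at hi hl
  rw [zero_pow (by omega), zero_div, mul_zero]

theorem splineBlock_sub_neg {n k : ℕ} (hn : 2 ≤ n) (hk : k ≤ n) (y : ℝ) :
    splineBlock n (n - k) (-y) = splineBlock n k y := by
  unfold splineBlock
  rw [Nat.choose_symm hk, Nat.sub_sub_self hk, Finset.sum_comm]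
  congr 1
  refine Finset.sum_congr rfl fun i hi => Finset.sum_congr rfl fun l hl => ?_
  rw [Finset.mem_range] at hi hl
  have h1 : 3 * n - 2 - l - i = 3 * n - 2 - i - l := by omega
  rw [h1, neg_pow (n : ℝ) (n - k - l), neg_pow (n : ℝ) (k - i), neg_pow y]
  have h2 : (-1 : ℝ) ^ (n - k - l) * (-1) ^ (3 * n - 2 - i - l) = (-1) ^ (k - i) := by
    rw [← pow_add]
    refine neg_one_pow_congr ?_
    rw [Nat.even_iff, Nat.even_iff]
    omega
  rw [← h2]
  ring

/-- The blocks are exchanged by `x ↦ -x`, so that the spline is odd as soon as the sum of its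
untruncated blocks vanishes. -/
theorem radialSpline_neg {n : ℕ} (hn : 2 ≤ n)
    (h : ∀ x : ℝ, ∑ k ∈ Finset.range (n + 1), splineBlock n k ((2 * k - n) / n - x) = 0) (x : ℝ) :
    radialSpline n (-x) = -radialSpline n x := by
  have hn0 : (n : ℝ) ≠ 0 := by positivity
  have h1 : ∑ k ∈ Finset.range (n + 1), splineBlock n k (max ((2 * k - n) / n - -x) 0)
      = ∑ k ∈ Finset.range (n + 1), splineBlock n k (min ((2 * k - n) / n - x) 0) := by
    rw [← Finset.sum_range_reflect]
    refine Finset.sum_congr rfl fun k hk => ?_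
    have hk : k ≤ n := by simpa [Nat.lt_succ_iff] using hk
    rw [show n + 1 - 1 - k = n - k by omega, ← splineBlock_sub_neg hn hk, Nat.cast_sub hk]
    congr 1
    rw [← max_neg_neg, neg_zero]
    congr 1
    field_simp
    ring
  -- `min y 0` and `max y 0` are `y` and `0` in some order, and a block vanishes at `0`.
  have h2 : ∀ k ∈ Finset.range (n + 1), splineBlock n k (min ((2 * k - n) / n - x) 0) =
      splineBlock n k ((2 * k - n) / n - x) - splineBlock n k (max ((2 * k - n) / n - x) 0) := by
    intro k hk
    have hk : k ≤ n := by simpa [Nat.lt_succ_iff] using hk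
    rcases le_total ((2 * (k : ℝ) - n) / n - x) 0 with h3 | h3
    · rw [min_eq_left h3, max_eq_right h3, splineBlock_zero hn hk, sub_zero]
    · rw [min_eq_right h3, max_eq_left h3, splineBlock_zero hn hk, sub_self]
  unfold radialSpline
  rw [h1, Finset.sum_congr rfl h2, Finset.sum_sub_distrib, h, zero_sub, mul_neg]

theorem radialSpline_eq_zero {n : ℕ} (hn : 2 ≤ n) {x : ℝ} (hx : 1 ≤ x) : radialSpline n x = 0 := by
  unfold radialSpline
  rw [Finset.sum_eq_zero, mul_zero]
  intro k hk
  have hk : k ≤ n := by simpa [Nat.lt_succ_iff] using hk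
  have hn0 : (0 : ℝ) < n := by positivity
  have hk' : (k : ℝ) ≤ n := by exact_mod_cast hk
  have : (2 * (k : ℝ) - n) / n ≤ 1 := by
    rw [div_le_one hn0]
    linarith
  rw [max_eq_right (by linarith), splineBlock_zero hn hk]

theorem integral_splineBlock_mul_exp {n k : ℕ} (hn : 2 ≤ n) (hk : k ≤ n) (a : ℝ) {u : ℝ}
    (hu : 0 < u) :
    Integrable (fun x : ℝ => splineBlock n k (max (a - x) 0) * Real.exp (u * x)) ∧
    ∫ x : ℝ, splineBlock n k (max (a - x) 0) * Real.exp (u * x)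
      = n.choose k * (u - n) ^ k * (u + n) ^ (n - k) * Real.exp (u * a) / u ^ (3 * n - 1) := by
  have e : ∀ x : ℝ, splineBlock n k (max (a - x) 0) * Real.exp (u * x) =
      n.choose k * ∑ i ∈ Finset.range (k + 1), ∑ l ∈ Finset.range (n - k + 1),
        (k.choose i * (n - k).choose l * (-n : ℝ) ^ (k - i) * (n : ℝ) ^ (n - k - l) /
          (3 * n - 2 - i - l).factorial) *
            (max (a - x) 0 ^ (3 * n - 2 - i - l) * Real.exp (u * x)) := by
    intro x
    unfold splineBlock
    rw [mul_assoc, Finset.sum_mul]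
    simp_rw [Finset.sum_mul]
    congr 1
    refine Finset.sum_congr rfl fun i _ => Finset.sum_congr rfl fun l _ => ?_
    ring
  have hm : ∀ i ∈ Finset.range (k + 1), ∀ l ∈ Finset.range (n - k + 1),
      3 * n - 2 - i - l ≠ 0 := by
    intro i hi l hl
    rw [Finset.mem_range] at hi hl
    omega
  have hI : ∀ i ∈ Finset.range (k + 1), ∀ l ∈ Finset.range (n - k + 1), Integrable fun x : ℝ =>
        (k.choose i * (n - k).choose l * (-n : ℝ) ^ (k - i) * (n : ℝ) ^ (n - k - l) /
          (3 * n - 2 - i - l).factorial) *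
            (max (a - x) 0 ^ (3 * n - 2 - i - l) * Real.exp (u * x)) :=
    fun i hi l hl => (integral_max_pow_mul_exp (hm i hi l hl) a hu).1.const_mul _
  simp_rw [e]
  constructor
  · exact (integrable_finsetSum _ fun i hi => integrable_finsetSum _ fun l hl =>
      hI i hi l hl).const_mul _
  · rw [integral_const_mul, integral_finsetSum _ fun i hi => integrable_finsetSum _ fun l hl =>
      hI i hi l hl]
    have e2 : ∀ i ∈ Finset.range (k + 1), ∫ x : ℝ, ∑ l ∈ Finset.range (n - k + 1),
        (k.choose i * (n - k).choose l * (-n : ℝ) ^ (k - i) * (n : ℝ) ^ (n - k - l) /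
          (3 * n - 2 - i - l).factorial) *
            (max (a - x) 0 ^ (3 * n - 2 - i - l) * Real.exp (u * x)) =
        ∑ l ∈ Finset.range (n - k + 1), (u ^ i * (-n : ℝ) ^ (k - i) * k.choose i) *
          (u ^ l * (n : ℝ) ^ (n - k - l) * (n - k).choose l) *
          (Real.exp (u * a) / u ^ (3 * n - 1)) := by
      intro i hi
      rw [integral_finsetSum _ (hI i hi)]
      refine Finset.sum_congr rfl fun l hl => ?_
      rw [integral_const_mul, (integral_max_pow_mul_exp (hm i hi l hl) a hu).2]
      rw [Finset.mem_range] at hi hl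
      have h1 : u ^ (3 * n - 1) = u ^ i * u ^ l * u ^ (3 * n - 2 - i - l + 1) := by
        rw [← pow_add, ← pow_add]
        congr 1
        omega
      have h2 : ((3 * n - 2 - i - l).factorial : ℝ) ≠ 0 := by positivity
      rw [h1]
      field_simp
    rw [Finset.sum_congr rfl e2]
    simp_rw [← Finset.sum_mul, ← Finset.mul_sum]
    rw [← Finset.sum_mul, ← add_pow, ← add_pow, ← sub_eq_add_neg]
    ring

theorem integral_radialSpline_mul_exp {n : ℕ} (hn : 2 ≤ n) {u : ℝ} (hu : 0 < u) :
    Integrable (fun x : ℝ => radialSpline n x * Real.exp (u * x)) ∧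
    ∫ x : ℝ, radialSpline n x * Real.exp (u * x) = 2 * u *
      (3 * (u / n * Real.cosh (u / n) - Real.sinh (u / n)) / (u / n) ^ 3) ^ n := by
  have e : ∀ x : ℝ, radialSpline n x * Real.exp (u * x) = 2 * (3 * n ^ 2 / 2 : ℝ) ^ n *
      ∑ k ∈ Finset.range (n + 1),
        splineBlock n k (max ((2 * k - n) / n - x) 0) * Real.exp (u * x) := by
    intro x
    rw [radialSpline, mul_assoc, Finset.sum_mul]
  have hI : ∀ k ∈ Finset.range (n + 1), Integrable fun x : ℝ =>
      splineBlock n k (max ((2 * k - n) / n - x) 0) * Real.exp (u * x) := fun k hk =>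
    (integral_splineBlock_mul_exp hn (by simpa [Nat.lt_succ_iff] using hk) _ hu).1
  simp_rw [e]
  refine ⟨(integrable_finsetSum _ hI).const_mul _, ?_⟩
  rw [integral_const_mul, integral_finsetSum _ hI]
  have hn0 : (n : ℝ) ≠ 0 := by positivity
  have h1 : ∀ k ∈ Finset.range (n + 1), ∫ x : ℝ,
      splineBlock n k (max ((2 * k - n) / n - x) 0) * Real.exp (u * x) =
      ((u - n) * Real.exp (u / n)) ^ k * ((u + n) * Real.exp (-(u / n))) ^ (n - k) * n.choose k *
        (1 / u ^ (3 * n - 1)) := by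
    intro k hk
    have hk : k ≤ n := by simpa [Nat.lt_succ_iff] using hk
    rw [(integral_splineBlock_mul_exp hn hk _ hu).2, mul_pow, mul_pow, ← Real.exp_nat_mul,
      ← Real.exp_nat_mul]
    have h2 : u * ((2 * (k : ℝ) - n) / n) = k * (u / n) + ((n - k : ℕ) : ℝ) * -(u / n) := by
      rw [Nat.cast_sub hk]
      field_simp
      ring
    rw [h2, Real.exp_add]
    ring
  rw [Finset.sum_congr rfl h1, ← Finset.sum_mul, ← add_pow]
  have h3 : u ^ (3 * n - 1) = (u ^ 3) ^ n / u := by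
    rw [eq_div_iff hu.ne', ← pow_mul, ← pow_succ]
    congr 1
    omega
  have h4 : 3 * (u / n * Real.cosh (u / n) - Real.sinh (u / n)) / (u / n) ^ 3 =
      (3 * n ^ 2 / 2) * ((u - n) * Real.exp (u / n) + (u + n) * Real.exp (-(u / n))) / u ^ 3 := by
    rw [Real.cosh_eq, Real.sinh_eq]
    field_simp
    ring
  rw [h4, h3, div_pow _ (u ^ 3), mul_pow (3 * (n : ℝ) ^ 2 / 2)]
  field_simp

/-! ### The law of the length of the Bloch vector of a mixture -/

theorem setIntegral_radialSpline_mul_sinh {n : ℕ} (hn : 2 ≤ n)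
    (h : ∀ x : ℝ, ∑ k ∈ Finset.range (n + 1), splineBlock n k ((2 * k - n) / n - x) = 0)
    {u : ℝ} (hu : 0 < u) :
    ∫ x in Icc (0 : ℝ) 1, radialSpline n x * Real.sinh (u * x) = u *
      (3 * (u / n * Real.cosh (u / n) - Real.sinh (u / n)) / (u / n) ^ 3) ^ n := by
  obtain ⟨hI, hv⟩ := integral_radialSpline_mul_exp hn hu
  rw [integral_eq_integral_Ioi_add_neg hI] at hv
  have e : ∀ x : ℝ, radialSpline n x * Real.exp (u * x) +
      radialSpline n (-x) * Real.exp (u * -x) = 2 * (radialSpline n x * Real.sinh (u * x)) := by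
    intro x
    rw [radialSpline_neg hn h, Real.sinh_eq, mul_neg]
    ring
  simp_rw [e] at hv
  rw [integral_const_mul] at hv
  have h1 : ∫ x in Ioi (0 : ℝ), radialSpline n x * Real.sinh (u * x) =
      ∫ x in Icc (0 : ℝ) 1, radialSpline n x * Real.sinh (u * x) := by
    rw [integral_Icc_eq_integral_Ioc]
    refine (setIntegral_eq_of_subset_of_forall_sdiff_eq_zero measurableSet_Ioi
      Ioc_subset_Ioi_self fun x hx => ?_)
    have : 1 < x := by
      by_contra hc
      exact hx.2 ⟨hx.1, not_lt.1 hc⟩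
    rw [radialSpline_eq_zero hn this.le, zero_mul]
  rw [← h1]
  linarith

theorem inner_blochVector_equiprobableMixture {n : ℕ} (v : EuclideanSpace ℝ (Fin 3))
    (ρ : Fin n → Matrix (Fin 2) (Fin 2) ℂ) :
    inner ℝ v (blochVector (equiprobableMixture ρ))
      = ∑ j, inner ℝ ((n : ℝ)⁻¹ • v) (blochVector (ρ j)) := by
  have h : blochVector (equiprobableMixture ρ) = (n : ℝ)⁻¹ • ∑ j, blochVector (ρ j) := by
    ext i
    have h1 : (1 / n : ℂ) = (((n : ℝ)⁻¹ : ℝ) : ℂ) := by push_cast; ring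
    simp only [blochVector, equiprobableMixture, h1, Matrix.smul_mul, Matrix.sum_mul,
      Matrix.trace_smul, Matrix.trace_sum, smul_eq_mul, Complex.re_ofReal_mul, Complex.re_sum,
      PiLp.smul_apply, WithLp.ofLp_sum, Finset.sum_apply]
  rw [h, real_inner_smul_right, inner_sum, Finset.mul_sum]
  simp_rw [real_inner_smul_left]

/-- The Bloch vector of the mixture is the mean of `n` independent Bloch vectors, so that its
moment-generating function is a power of that of a single one. -/
theorem lintegral_exp_inner_blochVector_mixture {Ω : Type*} [MeasurableSpace Ω] {P : Measure Ω}
    [IsProbabilityMeasure P] {n : ℕ} (hn : n ≠ 0) {ρ : Fin n → Ω → Matrix (Fin 2) (Fin 2) ℂ}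
    (hρ : IsIndepE22 P ρ) {v : EuclideanSpace ℝ (Fin 3)} (hv : v ≠ 0) :
    ∫⁻ ω, ENNReal.ofReal (Real.exp
        (inner ℝ v (blochVector (equiprobableMixture fun j => ρ j ω)))) ∂P
      = ENNReal.ofReal ((3 * (‖v‖ / n * Real.cosh (‖v‖ / n) - Real.sinh (‖v‖ / n)) /
          (‖v‖ / n) ^ 3) ^ n) := by
  have hn0 : (n : ℝ) ≠ 0 := by positivity
  have hw : (n : ℝ)⁻¹ • v ≠ 0 := smul_ne_zero (inv_ne_zero hn0) hv
  have hwn : ‖(n : ℝ)⁻¹ • v‖ = ‖v‖ / n := by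
    rw [norm_smul, norm_inv, Real.norm_natCast]
    ring
  obtain ⟨hI, hmgf⟩ := mgf_inner_blochVector_inducedEnsemble hw
  rw [hwn] at hmgf
  set w := (n : ℝ)⁻¹ • v
  have hm : Measurable fun M => inner ℝ w (blochVector M) := measurable_blochVector.const_inner
  have hme : Measurable fun M => Real.exp (inner ℝ w (blochVector M)) := hm.exp
  let X : Fin n → Ω → ℝ := fun j ω => inner ℝ w (blochVector (ρ j ω))
  have hX : iIndepFun X P := hρ.1.comp (fun _ M => inner ℝ w (blochVector M)) fun _ => hm
  have hXm : ∀ j, AEMeasurable (X j) P := fun j => hm.comp_aemeasurable (hρ.2 j).aemeasurable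
  have hXI : ∀ j, Integrable (fun ω => Real.exp (1 * X j ω)) P := by
    intro j
    rw [← (hρ.2 j).map_eq, integrable_map_measure hme.aestronglyMeasurable
      (hρ.2 j).aemeasurable] at hI
    simpa only [one_mul, Function.comp_def] using hI
  have hXv : ∀ j, mgf (X j) P 1 = 3 * (‖v‖ / n * Real.cosh (‖v‖ / n) - Real.sinh (‖v‖ / n)) /
      (‖v‖ / n) ^ 3 := by
    intro j
    rw [← (hρ.2 j).map_eq, integral_map (hρ.2 j).aemeasurable
      hme.aestronglyMeasurable] at hmgf
    simpa only [mgf, one_mul] using hmgf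
  have hsum := hX.mgf_sum₀ (t := 1) hXm Finset.univ
  -- A nonzero Bochner integral certifies integrability.
  have hne : mgf (∑ j, X j) P 1 ≠ 0 := by
    rw [hsum]
    exact Finset.prod_ne_zero_iff.2 fun j _ => (mgf_pos (hXI j)).ne'
  have hint : Integrable (fun ω => Real.exp (1 * (∑ j, X j) ω)) P := by
    by_contra hc
    exact hne (integral_undef hc)
  simp_rw [hXv, Finset.prod_const, Finset.card_univ, Fintype.card_fin] at hsum
  rw [← hsum, mgf, ofReal_integral_eq_lintegral_ofReal hint
    (Filter.Eventually.of_forall fun _ => (Real.exp_pos _).le)]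
  refine lintegral_congr fun ω => ?_
  rw [inner_blochVector_equiprobableMixture, one_mul, Finset.sum_apply]

/-- The law of the Bloch length of the mixture, under two conditions on the spline that are checked
for each `n` by explicit computation. -/
theorem isDensityOnUnitInterval_radialSpline {Ω : Type*} [MeasurableSpace Ω] {P : Measure Ω}
    [IsProbabilityMeasure P] {n : ℕ} (hn : 2 ≤ n)
    (h : ∀ x : ℝ, ∑ k ∈ Finset.range (n + 1), splineBlock n k ((2 * k - n) / n - x) = 0)
    (hpos : ∀ r ∈ Icc (0 : ℝ) 1, 0 ≤ r * radialSpline n r)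
    {ρ : Fin n → Ω → Matrix (Fin 2) (Fin 2) ℂ} (hρ : IsIndepE22 P ρ) :
    IsDensityOnUnitInterval (P.map (mixtureBlochLength ρ)) fun r => r * radialSpline n r := by
  refine ⟨hpos, ?_⟩
  have hc : Continuous fun r => r * radialSpline n r :=
    continuous_id.mul (continuous_radialSpline n)
  set ν := (volume.restrict (Icc (0 : ℝ) 1)).withDensity
    fun r => ENNReal.ofReal (r * radialSpline n r) with hν
  have hfin : IsFiniteMeasure ν :=
    isFiniteMeasure_withDensity_ofReal (hc.continuousOn.integrableOn_Icc).2
  have hν1 : ∀ᵐ r ∂ν, r ∈ Ioc (0 : ℝ) 1 := by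
    refine (withDensity_absolutelyContinuous _ _).ae_le ?_
    rw [← restrict_Ioc_eq_restrict_Icc]
    exact ae_restrict_mem measurableSet_Ioc
  have hV : AEMeasurable (fun ω => blochVector (equiprobableMixture fun j => ρ j ω)) P := by
    refine measurable_blochVector.comp_aemeasurable ?_
    refine aemeasurable_pi_iff.2 fun i => aemeasurable_pi_iff.2 fun k => ?_
    have h0 : Measurable fun M : Matrix (Fin 2) (Fin 2) ℂ => M i k :=
      (measurable_pi_apply k).comp (measurable_pi_apply i)
    have h1 : ∀ j, AEMeasurable (fun ω => ρ j ω i k) P := fun j =>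
      h0.comp_aemeasurable (hρ.2 j).aemeasurable
    have h2 : (fun ω => equiprobableMixture (fun j => ρ j ω) i k) =
        fun ω => (1 / n : ℂ) * ∑ j, ρ j ω i k := by
      funext ω
      simp [equiprobableMixture, Matrix.sum_apply]
    rw [h2]
    fun_prop
  refine map_norm_eq_of_lintegral_exp_inner hV hν1 fun v hv => ?_
  have hv0 : 0 < ‖v‖ := norm_pos_iff.2 hv
  rw [lintegral_exp_inner_blochVector_mixture (by omega) hρ hv, hν,
    lintegral_withDensity_eq_lintegral_mul₀ hc.measurable.ennreal_ofReal.aemeasurable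
      (by simp only [Real.sinh_eq]; fun_prop)]
  have hcs : Continuous fun r => radialSpline n r * Real.sinh (‖v‖ * r) :=
    (continuous_radialSpline n).mul (Real.continuous_sinh.comp (by fun_prop))
  have e : ∀ r ∈ Icc (0 : ℝ) 1, ((fun r => ENNReal.ofReal (r * radialSpline n r)) *
      fun r => ENNReal.ofReal (Real.sinh (‖v‖ * r) / (‖v‖ * r))) r =
      ENNReal.ofReal (‖v‖⁻¹ * (radialSpline n r * Real.sinh (‖v‖ * r))) := by
    intro r hr
    rw [Pi.mul_apply, ← ENNReal.ofReal_mul (hpos r hr)]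
    congr 1
    -- At `r = 0`, where the quotient by `‖v‖ * r` takes a junk value, the density vanishes.
    rcases eq_or_ne r 0 with rfl | hr0
    · simp
    · field_simp
  rw [setLIntegral_congr_fun measurableSet_Icc e, ← ofReal_integral_eq_lintegral_ofReal,
    integral_const_mul, setIntegral_radialSpline_mul_sinh hn h hv0, inv_mul_cancel_left₀ hv0.ne']
  · exact (hcs.const_mul _).continuousOn.integrableOn_Icc
  · filter_upwards [ae_restrict_mem measurableSet_Icc] with r hr
    rcases eq_or_lt_of_le hr.1 with h0 | h0
    · simp [← h0]
    · have h1 := nonneg_of_mul_nonneg_right (hpos r hr) h0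
      have h2 := Real.sinh_nonneg_iff.2 (mul_nonneg hv0.le hr.1)
      simp only [Pi.zero_apply]
      positivity

/-! ### The splines for three, four and five qubits -/

theorem sum_splineBlock_three (x : ℝ) :
    ∑ k ∈ Finset.range (3 + 1), splineBlock 3 k ((2 * k - (3 : ℕ)) / (3 : ℕ) - x) = 0 := by
  simp [splineBlock, Finset.sum_range_succ, Nat.choose, Nat.factorial]
  ring

theorem radialSpline_three (x : ℝ) : radialSpline 3 x = 19683 / 4 *
    (splineBlock 3 0 (max (-1 - x) 0) + splineBlock 3 1 (max (-1 / 3 - x) 0) +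
      splineBlock 3 2 (max (1 / 3 - x) 0) + splineBlock 3 3 (max (1 - x) 0)) := by
  simp only [radialSpline, Finset.sum_range_succ, Finset.sum_range_zero]
  norm_num

theorem mul_radialSpline_three_right {x : ℝ} (h : 1 / 3 ≤ x) (h1 : x ≤ 1) :
    x * radialSpline 3 x =
      6561 / 2240 * (1 - x) ^ 4 * x * (9 * x ^ 3 + 36 * x ^ 2 + 27 * x - 2) := by
  rw [radialSpline_three, max_eq_right (by linarith : -1 - x ≤ 0),
    max_eq_right (by linarith : -1 / 3 - x ≤ 0),
    max_eq_right (by linarith : 1 / 3 - x ≤ 0),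
    max_eq_left (by linarith : 0 ≤ 1 - x)]
  simp [splineBlock, Finset.sum_range_succ, Nat.choose, Nat.factorial]
  ring

theorem mul_radialSpline_three_left {x : ℝ} (h : 0 ≤ x) (h1 : x ≤ 1 / 3) :
    x * radialSpline 3 x =
      -(243 / 1120) * x ^ 2 * (243 * x ^ 6 - 1701 * x ^ 4 + 945 * x ^ 2 - 175) := by
  rw [radialSpline_three, max_eq_right (by linarith : -1 - x ≤ 0),
    max_eq_right (by linarith : -1 / 3 - x ≤ 0),
    max_eq_left (by linarith : 0 ≤ 1 / 3 - x),
    max_eq_left (by linarith : 0 ≤ 1 - x)]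
  simp [splineBlock, Finset.sum_range_succ, Nat.choose, Nat.factorial]
  ring

theorem sum_splineBlock_four (x : ℝ) :
    ∑ k ∈ Finset.range (4 + 1), splineBlock 4 k ((2 * k - (4 : ℕ)) / (4 : ℕ) - x) = 0 := by
  simp [splineBlock, Finset.sum_range_succ, Nat.choose, Nat.factorial]
  ring

theorem radialSpline_four (x : ℝ) : radialSpline 4 x = 663552 *
    (splineBlock 4 0 (max (-1 - x) 0) + splineBlock 4 1 (max (-1 / 2 - x) 0) +
      splineBlock 4 2 (max (0 - x) 0) + splineBlock 4 3 (max (1 / 2 - x) 0) +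
      splineBlock 4 4 (max (1 - x) 0)) := by
  simp only [radialSpline, Finset.sum_range_succ, Finset.sum_range_zero]
  norm_num

theorem mul_radialSpline_four_right {x : ℝ} (h : 1 / 2 ≤ x) (h1 : x ≤ 1) :
    x * radialSpline 4 x = 512 / 175 * (1 - x) ^ 6 * x *
      (16 * x ^ 4 + 96 * x ^ 3 + 156 * x ^ 2 + 56 * x - 9) := by
  rw [radialSpline_four, max_eq_right (by linarith : -1 - x ≤ 0),
    max_eq_right (by linarith : -1 / 2 - x ≤ 0),
    max_eq_right (by linarith : 0 - x ≤ 0),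
    max_eq_right (by linarith : 1 / 2 - x ≤ 0),
    max_eq_left (by linarith : 0 ≤ 1 - x)]
  simp [splineBlock, Finset.sum_range_succ, Nat.choose, Nat.factorial]
  ring

theorem mul_radialSpline_four_left {x : ℝ} (h : 0 ≤ x) (h1 : x ≤ 1 / 2) :
    x * radialSpline 4 x = -(128 / 175) * x ^ 2 * (192 * x ^ 9 - 2160 * x ^ 7 + 960 * x ^ 6 +
      3780 * x ^ 5 - 3528 * x ^ 4 + 720 * x ^ 2 - 85) := by
  rw [radialSpline_four, max_eq_right (by linarith : -1 - x ≤ 0),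
    max_eq_right (by linarith : -1 / 2 - x ≤ 0),
    max_eq_right (by linarith : 0 - x ≤ 0),
    max_eq_left (by linarith : 0 ≤ 1 / 2 - x),
    max_eq_left (by linarith : 0 ≤ 1 - x)]
  simp [splineBlock, Finset.sum_range_succ, Nat.choose, Nat.factorial]
  ring

theorem sum_splineBlock_five (x : ℝ) :
    ∑ k ∈ Finset.range (5 + 1), splineBlock 5 k ((2 * k - (5 : ℕ)) / (5 : ℕ) - x) = 0 := by
  simp [splineBlock, Finset.sum_range_succ, Nat.choose, Nat.factorial]
  ring

theorem radialSpline_five (x : ℝ) : radialSpline 5 x = 2373046875 / 16 *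
    (splineBlock 5 0 (max (-1 - x) 0) + splineBlock 5 1 (max (-3 / 5 - x) 0) +
      splineBlock 5 2 (max (-1 / 5 - x) 0) + splineBlock 5 3 (max (1 / 5 - x) 0) +
      splineBlock 5 4 (max (3 / 5 - x) 0) + splineBlock 5 5 (max (1 - x) 0)) := by
  simp only [radialSpline, Finset.sum_range_succ, Finset.sum_range_zero]
  norm_num

theorem mul_radialSpline_five_right {x : ℝ} (h : 3 / 5 ≤ x) (h1 : x ≤ 1) :
    x * radialSpline 5 x = 1953125 / 16400384 * (1 - x) ^ 8 * x *
      (625 * x ^ 5 + 5000 * x ^ 4 + 12750 * x ^ 3 + 11300 * x ^ 2 + 1825 * x - 612) := by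
  rw [radialSpline_five, max_eq_right (by linarith : -1 - x ≤ 0),
    max_eq_right (by linarith : -3 / 5 - x ≤ 0),
    max_eq_right (by linarith : -1 / 5 - x ≤ 0),
    max_eq_right (by linarith : 1 / 5 - x ≤ 0),
    max_eq_right (by linarith : 3 / 5 - x ≤ 0),
    max_eq_left (by linarith : 0 ≤ 1 - x)]
  simp [splineBlock, Finset.sum_range_succ, Nat.choose, Nat.factorial]
  ring

theorem mul_radialSpline_five_middle {x : ℝ} (h : 1 / 5 ≤ x) (h1 : x ≤ 3 / 5) :
    x * radialSpline 5 x = -(5 / 4100096) * x *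
      (244140625 * x ^ 13 - 3808593750 * x ^ 11 + 2792968750 * x ^ 10 + 12568359375 * x ^ 9 -
        19103906250 * x ^ 8 - 670312500 * x ^ 7 + 18098437500 * x ^ 6 - 12978590625 * x ^ 5 +
        2511437500 * x ^ 4 + 360038250 * x ^ 3 + 44625750 * x ^ 2 - 75822175 * x + 67086) := by
  rw [radialSpline_five, max_eq_right (by linarith : -1 - x ≤ 0),
    max_eq_right (by linarith : -3 / 5 - x ≤ 0),
    max_eq_right (by linarith : -1 / 5 - x ≤ 0),
    max_eq_right (by linarith : 1 / 5 - x ≤ 0),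
    max_eq_left (by linarith : 0 ≤ 3 / 5 - x),
    max_eq_left (by linarith : 0 ≤ 1 - x)]
  simp [splineBlock, Finset.sum_range_succ, Nat.choose, Nat.factorial]
  ring

theorem mul_radialSpline_five_left {x : ℝ} (h : 0 ≤ x) (h1 : x ≤ 1 / 5) :
    x * radialSpline 5 x = 125 / 8200192 * x ^ 2 *
      (29296875 * x ^ 12 - 457031250 * x ^ 10 + 1508203125 * x ^ 8 - 938437500 * x ^ 6 +
        316441125 * x ^ 4 - 63050130 * x ^ 2 + 5855707) := by
  rw [radialSpline_five, max_eq_right (by linarith : -1 - x ≤ 0),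
    max_eq_right (by linarith : -3 / 5 - x ≤ 0),
    max_eq_right (by linarith : -1 / 5 - x ≤ 0),
    max_eq_left (by linarith : 0 ≤ 1 / 5 - x),
    max_eq_left (by linarith : 0 ≤ 3 / 5 - x),
    max_eq_left (by linarith : 0 ≤ 1 - x)]
  simp [splineBlock, Finset.sum_range_succ, Nat.choose, Nat.factorial]
  ring

/-- The Bernstein coefficients of the polynomial on `[0, 1 / 2]` are positive. -/
theorem four_left_factor_nonneg {x : ℝ} (h : 0 ≤ x) (h1 : x ≤ 1 / 2) :
    0 ≤ -(192 * x ^ 9 - 2160 * x ^ 7 + 960 * x ^ 6 + 3780 * x ^ 5 - 3528 * x ^ 4 + 720 * x ^ 2 -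
      85) := by
  have key : ∀ s t : ℝ, 0 ≤ s → 0 ≤ t → 0 ≤
      43520 * t ^ 9 + 391680 * s ^ 1 * t ^ 8 + 1474560 * s ^ 2 * t ^ 7 + 3010560 * s ^ 3 * t ^ 6 +
      3661056 * s ^ 4 * t ^ 5 + 2761920 * s ^ 5 * t ^ 4 + 1309440 * s ^ 6 * t ^ 3 +
      383040 * s ^ 7 * t ^ 2 + 63360 * s ^ 8 * t ^ 1 + 4544 * s ^ 9 := by
    intro s t hs ht
    positivity
  have h2 := key (x - 0) (1 / 2 - x) (by linarith) (by linarith)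
  refine h2.trans_eq ?_
  ring

/-- The Bernstein coefficients of the polynomial on `[1 / 5, 3 / 5]` are positive. -/
theorem five_middle_factor_nonneg {x : ℝ} (h : 1 / 5 ≤ x) (h1 : x ≤ 3 / 5) :
    0 ≤ -(244140625 * x ^ 13 - 3808593750 * x ^ 11 + 2792968750 * x ^ 10 +
      12568359375 * x ^ 9 - 19103906250 * x ^ 8 - 670312500 * x ^ 7 + 18098437500 * x ^ 6 -
      12978590625 * x ^ 5 + 2511437500 * x ^ 4 + 360038250 * x ^ 3 + 44625750 * x ^ 2 -
      75822175 * x + 67086) := by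
  have key : ∀ s t : ℝ, 0 ≤ s → 0 ≤ t → 0 ≤
      22552978515625 / 16 * t ^ 13 + 298374755859375 / 16 * s ^ 1 * t ^ 12 +
      867435791015625 / 8 * s ^ 2 * t ^ 11 + 2938517333984375 / 8 * s ^ 3 * t ^ 10 +
      12955360107421875 / 16 * s ^ 4 * t ^ 9 + 19660370361328125 / 16 * s ^ 5 * t ^ 8 +
      1324600341796875 * s ^ 6 * t ^ 7 + 1031233886718750 * s ^ 7 * t ^ 6 +
      9321637939453125 / 16 * s ^ 8 * t ^ 5 + 3791629638671875 / 16 * s ^ 9 * t ^ 4 +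
      541591552734375 / 8 * s ^ 10 * t ^ 3 + 103203369140625 / 8 * s ^ 11 * t ^ 2 +
      23572021484375 / 16 * s ^ 12 * t ^ 1 + 1220947265625 / 16 * s ^ 13 := by
    intro s t hs ht
    positivity
  have h2 := key (x - 1 / 5) (3 / 5 - x) (by linarith) (by linarith)
  refine h2.trans_eq ?_
  ring

theorem mul_radialSpline_three_nonneg {x : ℝ} (hx : x ∈ Icc (0 : ℝ) 1) :
    0 ≤ x * radialSpline 3 x := by
  obtain ⟨h0, h1⟩ := hx
  rcases le_total (1 / 3) x with h | h
  · rw [mul_radialSpline_three_right h h1]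
    have : 0 ≤ 9 * x ^ 3 + 36 * x ^ 2 + 27 * x - 2 := by
      nlinarith [pow_nonneg h0 3, pow_nonneg h0 2]
    have : 0 ≤ 1 - x := by linarith
    positivity
  · rw [mul_radialSpline_three_left h0 h]
    have h2 : x ^ 2 ≤ 1 / 9 := by nlinarith
    have h3 : 243 * x ^ 6 - 1701 * x ^ 4 + 945 * x ^ 2 - 175 ≤ 0 := by
      nlinarith [mul_nonneg (pow_nonneg h0 4) (sub_nonneg.2 h2), pow_nonneg h0 4]
    nlinarith [mul_nonneg (sq_nonneg x) (neg_nonneg.2 h3)]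

theorem mul_radialSpline_four_nonneg {x : ℝ} (hx : x ∈ Icc (0 : ℝ) 1) :
    0 ≤ x * radialSpline 4 x := by
  obtain ⟨h0, h1⟩ := hx
  rcases le_total (1 / 2) x with h | h
  · rw [mul_radialSpline_four_right h h1]
    have : 0 ≤ 16 * x ^ 4 + 96 * x ^ 3 + 156 * x ^ 2 + 56 * x - 9 := by
      nlinarith [pow_nonneg h0 4, pow_nonneg h0 3, pow_nonneg h0 2]
    have : 0 ≤ 1 - x := by linarith
    positivity
  · rw [mul_radialSpline_four_left h0 h]
    nlinarith [mul_nonneg (sq_nonneg x) (four_left_factor_nonneg h0 h)]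

theorem mul_radialSpline_five_nonneg {x : ℝ} (hx : x ∈ Icc (0 : ℝ) 1) :
    0 ≤ x * radialSpline 5 x := by
  obtain ⟨h0, h1⟩ := hx
  rcases le_total (3 / 5) x with h | h
  · rw [mul_radialSpline_five_right h h1]
    have : 0 ≤ 625 * x ^ 5 + 5000 * x ^ 4 + 12750 * x ^ 3 + 11300 * x ^ 2 + 1825 * x - 612 := by
      nlinarith [pow_nonneg h0 5, pow_nonneg h0 4, pow_nonneg h0 3, pow_nonneg h0 2]
    have : 0 ≤ 1 - x := by linarith
    positivity
  rcases le_total (1 / 5) x with h' | h'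
  · rw [mul_radialSpline_five_middle h' h]
    nlinarith [mul_nonneg h0 (five_middle_factor_nonneg h' h)]
  · rw [mul_radialSpline_five_left h0 h']
    have h2 : x ^ 2 ≤ 1 / 25 := by nlinarith
    -- The terms are grouped in pairs, whose sums are nonnegative as `x ^ 2 ≤ 1 / 25`.
    have h3 : 0 ≤ 5855707 - 63050130 * x ^ 2 := by linarith
    have h4 : 0 ≤ x ^ 4 * (316441125 - 938437500 * x ^ 2) :=
      mul_nonneg (pow_nonneg h0 4) (by linarith)
    have h5 : 0 ≤ x ^ 8 * (1508203125 - 457031250 * x ^ 2) :=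
      mul_nonneg (pow_nonneg h0 8) (by linarith)
    refine mul_nonneg (by positivity) ?_
    linarith [pow_nonneg h0 12]

theorem mainTheorem1 {Ω : Type*} [MeasurableSpace Ω] (P : Measure Ω) [IsProbabilityMeasure P] :
    (∀ ρ : Fin 3 → Ω → Matrix (Fin 2) (Fin 2) ℂ, IsIndepE22 P ρ →
      ∃ p : ℝ → ℝ, IsDensityOnUnitInterval (P.map (mixtureBlochLength ρ)) p ∧
        (∀ r ∈ Icc (1 / 3 : ℝ) 1,
          p r = 6561 / 2240 * (1 - r) ^ 4 * r * (9 * r ^ 3 + 36 * r ^ 2 + 27 * r - 2)) ∧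
        (∀ r ∈ Icc (0 : ℝ) (1 / 3),
          p r = -(243 / 1120) * r ^ 2 * (243 * r ^ 6 - 1701 * r ^ 4 + 945 * r ^ 2 - 175))) ∧
    (∀ ρ : Fin 4 → Ω → Matrix (Fin 2) (Fin 2) ℂ, IsIndepE22 P ρ →
      ∃ p : ℝ → ℝ, IsDensityOnUnitInterval (P.map (mixtureBlochLength ρ)) p ∧
        (∀ r ∈ Icc (1 / 2 : ℝ) 1,
          p r = 512 / 175 * (1 - r) ^ 6 * r *
            (16 * r ^ 4 + 96 * r ^ 3 + 156 * r ^ 2 + 56 * r - 9)) ∧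
        (∀ r ∈ Icc (0 : ℝ) (1 / 2),
          p r = -(128 / 175) * r ^ 2 *
            (192 * r ^ 9 - 2160 * r ^ 7 + 960 * r ^ 6 + 3780 * r ^ 5 - 3528 * r ^ 4
              + 720 * r ^ 2 - 85))) ∧
    (∀ ρ : Fin 5 → Ω → Matrix (Fin 2) (Fin 2) ℂ, IsIndepE22 P ρ →
      ∃ p : ℝ → ℝ, IsDensityOnUnitInterval (P.map (mixtureBlochLength ρ)) p ∧
        (∀ r ∈ Icc (3 / 5 : ℝ) 1,
          p r = 1953125 / 16400384 * (1 - r) ^ 8 * r *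
            (625 * r ^ 5 + 5000 * r ^ 4 + 12750 * r ^ 3 + 11300 * r ^ 2 + 1825 * r - 612)) ∧
        (∀ r ∈ Icc (1 / 5 : ℝ) (3 / 5),
          p r = -(5 / 4100096) * r *
            (244140625 * r ^ 13 - 3808593750 * r ^ 11 + 2792968750 * r ^ 10
              + 12568359375 * r ^ 9 - 19103906250 * r ^ 8 - 670312500 * r ^ 7
              + 18098437500 * r ^ 6 - 12978590625 * r ^ 5 + 2511437500 * r ^ 4
              + 360038250 * r ^ 3 + 44625750 * r ^ 2 - 75822175 * r + 67086)) ∧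
        (∀ r ∈ Icc (0 : ℝ) (1 / 5),
          p r = 125 / 8200192 * r ^ 2 *
            (29296875 * r ^ 12 - 457031250 * r ^ 10 + 1508203125 * r ^ 8 - 938437500 * r ^ 6
              + 316441125 * r ^ 4 - 63050130 * r ^ 2 + 5855707))) := by
  refine ⟨fun ρ hρ => ⟨_, isDensityOnUnitInterval_radialSpline (by norm_num)
      sum_splineBlock_three (fun _ => mul_radialSpline_three_nonneg) hρ, ?_, ?_⟩,
    fun ρ hρ => ⟨_, isDensityOnUnitInterval_radialSpline (by norm_num) sum_splineBlock_four
      (fun _ => mul_radialSpline_four_nonneg) hρ, ?_, ?_⟩,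
    fun ρ hρ => ⟨_, isDensityOnUnitInterval_radialSpline (by norm_num) sum_splineBlock_five
      (fun _ => mul_radialSpline_five_nonneg) hρ, ?_, ?_, ?_⟩⟩
  · exact fun r hr => mul_radialSpline_three_right hr.1 hr.2
  · exact fun r hr => mul_radialSpline_three_left hr.1 hr.2
  · exact fun r hr => mul_radialSpline_four_right hr.1 hr.2
  · intro r hr
    exact (mul_radialSpline_four_left hr.1 hr.2).trans (by ring)
  · exact fun r hr => mul_radialSpline_five_right hr.1 hr.2
  · intro r hr
    exact (mul_radialSpline_five_middle hr.1 hr.2).trans (by ring)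
  · intro r hr
    exact (mul_radialSpline_five_left hr.1 hr.2).trans (by ring)
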